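/- **Setting.** Let $\Lambda$ be the finite vertex set of a connected graph, with graph distance $d_{i,j}$. For nonempty $X,Y\subseteq\Lambda$ let $d_{X,Y}=\min_{x\in X,y\in Y}d_{x,y}$, let $\partial X=\{i\in X: d_{\{i\},X^{c}}=1\}$ (so $\partial\Lambda=\emptyset$), and $i[r]=\{j: d_{i,j}\le r\}$. Let $D\ge 1$ be an integer and $\gamma\ge1$ a real number with $|\partial i[r]|\le\gamma r^{D-1}$ and $|i[r]|\le\gamma r^{D}$ for all $i\in\Lambda$ and real $r\ge1$. Each site carries the Hilbert space $\mathbb C^{d_0}$, $d_0\ge1$. Let $H=\sum_{Z\subseteq\Lambda}h_Z$ with $h_Z$ Hermitian and supported on $Z$, $h_Z=0$ if $|Z|>k$, $\sum_{Z\ni i}\|h_Z\|\le g$ for all $i$, and $\sum_{Z\supseteq\{i,j\}}\|h_Z\|\le g_0e^{-\mu_0 d_{i,j}}$ for all $i\ne j$, where $g,g_0,\mu_0>0$ (short-range interaction). Here $\|\cdot\|$ is the operator norm. Put $O(t)=e^{iHt}Oe^{-iHt}$ and, for $\beta>0$, $\rho_\beta=e^{-\beta H}/\operatorname{tr}e^{-\beta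 H}$. For $0\le\alpha\le1$ let $$Q^{(\alpha)}_{\rho}(O_A,O_B)=\operatorname{tr}(\rho\,O_AO_B)-\operatorname{tr}(\rho^{1-\alpha}O_A\rho^{\alpha}O_B),\qquad \bar Q_\rho(O_A,O_B)=\int_0^1Q_\rho^{(\alpha)}(O_A,O_B)\,d\alpha .$$ Positive numbers $C,v,\mu$ are called *Lieb–Robinson constants* of $H$ if for all nonempty $X,Y\subseteq\Lambda$ with $R=d_{X,Y}>0$, all operators $O_X,O_Y$ of unit norm supported on $X,Y$, and all $t\in\mathbb R$, $$\|[O_X(t),O_Y]\|\le C\min(|\partial X|,|\partial Y|)\,(e^{v|t|}-1)\,e^{-\mu R}.$$ **Theorem.** For all $D,k,\gamma,g,g_0,\mu_0$ there are $C,v,\mu>0$, depending only on these six parameters, that are Lieb–Robinson constants of every Hamiltonian $H$ as above. Moreover, for every such $H$, for these and for any other Lieb–Robinson constants $C,v,\mu>0$ of $H$, for every $\beta>0$, all nonempty proper subsets $A,B\subsetneq\Lambda$ (possibly overlapping) with $R=d_{A,B}$, and all operators $O_A,O_B$ of unit norm supported on $A$ and $B$, $$\bigl|Q^{(\alpha)}_{\rho_\beta}(O_A,O_B)\bigr|\le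 C'_\beta\min(|\partial A|,|\partial B|)\,e^{-R/\xi'_\beta}\qquad(0\le\alpha\le1),$$ where $$C'_\beta=\frac{12+2C}{\pi}+\frac{4C}{v\beta},\qquad \xi'_\beta=\frac{2+v\beta/\pi}{\mu}.$$ Also $\alpha\mapsto Q^{(\alpha)}_{\rho_\beta}(O_A,O_B)$ is integrable on $[0,1]$, and $|\bar Q_{\rho_\beta}(O_A,O_B)|$ obeys the same bound. -/

import Mathlib

open Real
open scoped Matrix.Norms.L2Operator MatrixOrder

universe u

/-! ## Geometry of the lattice -/

section Geometry

variable {Λ : Type u} [Fintype Λ] [DecidableEq Λ]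

/-- The distance `d_{X,Y}` between two sets of sites: the shortest length of a path on the graph
from `X` to `Y`. It is `0` when one of the sets is empty. -/
noncomputable def siteDist (G : SimpleGraph Λ) (X Y : Finset Λ) : ℕ :=
  sInf {n : ℕ | ∃ x ∈ X, ∃ y ∈ Y, G.dist x y = n}

/-- The surface `∂X` of `X`: the sites of `X` at distance one from the complement of `X`. -/
noncomputable def surface (G : SimpleGraph Λ) (X : Finset Λ) : Finset Λ :=
  X.filter fun i => siteDist G {i} Xᶜ = 1

/-- The ball `i[r]`. -/
noncomputable def siteBall (G : SimpleGraph Λ) (i : Λ) (r : ℝ) : Finset Λ :=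
  Finset.univ.filter fun j => (G.dist i j : ℝ) ≤ r

/-- `G` is a (finite, connected) lattice of dimension `D` with structure parameter `γ`. -/
structure IsLattice (G : SimpleGraph Λ) (D : ℕ) (γ : ℝ) : Prop where
  connected : G.Connected
  ball_surface_le : ∀ (i : Λ) (r : ℝ), 1 ≤ r → ((surface G (siteBall G i r)).card : ℝ) ≤ γ * r ^ (D - 1)
  ball_le : ∀ (i : Λ) (r : ℝ), 1 ≤ r → ((siteBall G i r).card : ℝ) ≤ γ * r ^ D

end Geometry

/-! ## Operators, Hamiltonians and Gibbs states -/

/-- Operators on the Hilbert space `⨂_{i ∈ Λ} ℂ^{d₀}`, as matrices in the product basis. The norm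
is the operator norm. -/
abbrev SpinOp (Λ : Type u) (d₀ : ℕ) : Type u := Matrix (Λ → Fin d₀) (Λ → Fin d₀) ℂ

section Operators

variable {Λ : Type u} [Fintype Λ] [DecidableEq Λ] {d₀ : ℕ}

/-- `O` is supported on `X`, that is, `O = M ⊗ 1` with `M` acting on the sites of `X` and the
identity acting on the other sites. -/
def SupportedOn (X : Finset Λ) (O : SpinOp Λ d₀) : Prop :=
  ∃ M : Matrix (X → Fin d₀) (X → Fin d₀) ℂ, ∀ σ τ : Λ → Fin d₀,
    O σ τ = M (fun i => σ i) (fun i => τ i) * (if ∀ i, i ∉ X → σ i = τ i then 1 else 0)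

/-- The Hamiltonian `H = ∑_Z h_Z`. -/
def hamiltonian (h : Finset Λ → SpinOp Λ d₀) : SpinOp Λ d₀ := ∑ Z, h Z

/-- The interaction `h` consists of Hermitian terms `h_Z` acting on the sites of `Z`, is `k`-local,
has one-site energy at most `g`, and is short-range: its strength between two sites at distance
`x` is at most `g₀ exp (-μ₀ x)`. -/
structure IsShortRange (G : SimpleGraph Λ) (h : Finset Λ → SpinOp Λ d₀)
    (k : ℕ) (g g₀ μ₀ : ℝ) : Prop where
  hermitian : ∀ Z, (h Z).IsHermitian
  supported : ∀ Z, SupportedOn Z (h Z)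
  few_body : ∀ Z, k < Z.card → h Z = 0
  one_site_le : ∀ i, ∑ Z with i ∈ Z, ‖h Z‖ ≤ g
  two_site_le : ∀ i j, i ≠ j →
    ∑ Z with i ∈ Z ∧ j ∈ Z, ‖h Z‖ ≤ g₀ * exp (-μ₀ * (G.dist i j : ℝ))

/-- The Gibbs state `ρ_β = exp (-βH) / tr exp (-βH)`. -/
noncomputable def gibbsState (H : SpinOp Λ d₀) (β : ℝ) : SpinOp Λ d₀ :=
  (Matrix.trace (NormedSpace.exp (((-β : ℝ) : ℂ) • H)))⁻¹ • NormedSpace.exp (((-β : ℝ) : ℂ) • H)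

/-- The time evolution `O(t) = exp (iHt) O exp (-iHt)`. -/
noncomputable def timeEvolution (H O : SpinOp Λ d₀) (t : ℝ) : SpinOp Λ d₀ :=
  NormedSpace.exp ((Complex.I * (t : ℂ)) • H) * O * NormedSpace.exp ((-(Complex.I * (t : ℂ))) • H)

/-- The Lieb–Robinson bound with the constants `C`, `v`, `μ`. -/
def LiebRobinsonBound (G : SimpleGraph Λ) (H : SpinOp Λ d₀) (C v μ : ℝ) : Prop :=
  ∀ (X Y : Finset Λ), X.Nonempty → Y.Nonempty → 0 < siteDist G X Y →
  ∀ (OX OY : SpinOp Λ d₀), SupportedOn X OX → SupportedOn Y OY → ‖OX‖ = 1 → ‖OY‖ = 1 →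
  ∀ t : ℝ,
    ‖timeEvolution H OX t * OY - OY * timeEvolution H OX t‖ ≤
      C * (min (surface G X).card (surface G Y).card : ℕ) * (exp (v * |t|) - 1) *
        exp (-μ * (siteDist G X Y : ℝ))

/-- The Wigner–Yanase–Dyson quantum correlation
`Q_ρ^(α)(O_A, O_B) = tr (ρ O_A O_B) - tr (ρ^(1-α) O_A ρ^α O_B)`. -/
noncomputable def wydCorrelation (ρ : SpinOp Λ d₀) (α : ℝ) (OA OB : SpinOp Λ d₀) : ℂ :=
  Matrix.trace (ρ * OA * OB) - Matrix.trace (ρ ^ (1 - α) * OA * ρ ^ α * OB)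

end Operators

/-- The constant `C'_β`. -/
noncomputable def clusterConst (C v β : ℝ) : ℝ := (12 + 2 * C) / π + 4 * C / (v * β)

/-- The quantum correlation length `ξ'_β`. -/
noncomputable def clusterLength (v μ β : ℝ) : ℝ := (2 + v * β / π) / μ

/-! ### Operators supported on sets of sites. -/

section Support

variable {Λ : Type u} [Fintype Λ] [DecidableEq Λ] {d₀ : ℕ}

/-! The proof has two independent halves: a Lieb–Robinson bound, and a passage from any such bound
to clustering.

Lieb–Robinson. Dropping from the dynamics the terms that cross the boundary of the support X keeps
the evolved operator on X. Duhamel's formula therefore bounds the growth of ‖[O(t), O_Y]‖ by the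
same quantity for the crossing terms (`exists_norm_commutator_le`). Weight the sites by a(l) =
exp(-(μ₀/2) d(l,Y)). Half of the decay rate μ₀ makes the matrix of pair strengths satisfy J a ≤ K a,
with K = g + g₀S and S a lattice sum. Iteration then gives the bound 2‖O‖ exp(2Kt) ∑ a over the
support. A last Duhamel step, now counting pairs with one site in X and one outside, replaces the
support by its surface, since every geodesic leaving X meets ∂X.

Clustering. Let p be the Gibbs weights and E the energies, put ω = E_j - E_k, and let A, B be the
matrices of O_A, O_B in an energy eigenbasis. Then Q^(α) = ∑ (p_j - p_k) A_jk B_kj (exp(αβω) -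
1)/(exp(βω) - 1), while the same weights w = (p_j - p_k) A_jk B_kj give ∑ w exp(iωt) = tr(ρ[O_A(t),
O_B]). The thermal filter minus α is a continuous 1-periodic function of α, so it has a Fourier
series (`hasSum_exp_sub_id`). Its mode n involves 1/(2πn/β ± iω), a Laplace transform of exp(∓iωt).
Terms independent of ω drop out because ∑ w = 0, the commutator being zero at time 0. Hence Q^(α) is
controlled by integrating |tr(ρ[O_A(±t), O_B])| against the geometric kernel e^{-ct}/(1 - e^{-ct})
with c = 2π/β (`norm_sum_thermal_filter_le`).

The kernel is singular like 1/(ct) at 0, where the Lieb–Robinson bound vanishes linearly, and it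
decays like e^{-ct} at late times, where the trivial commutator bound suffices. Cutting at the time
t₀ where the two exponentials agree gives decay e^{-s} with s = μR/(1 + vβ/2π). The theorem asks
only for e^{-s/2}; the slack absorbs constants when s ≥ 1, and for s ≤ 1 the bound |Q| ≤ 2 is enough
(`norm_wydCorrelation_le`). -/

/-- The embedding `M ↦ M ⊗ 1` of the operators on the sites of `X` into all operators. -/
noncomputable def localEmbedding (d₀ : ℕ) (X : Finset Λ) :
    Matrix (X → Fin d₀) (X → Fin d₀) ℂ →+* SpinOp Λ d₀ where
  toFun M := (Matrix.kroneckerMap (· * ·) M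
    (1 : Matrix ({i // i ∉ X} → Fin d₀) ({i // i ∉ X} → Fin d₀) ℂ)).submatrix
      (Equiv.piEquivPiSubtypeProd (· ∈ X) fun _ => Fin d₀)
      (Equiv.piEquivPiSubtypeProd (· ∈ X) fun _ => Fin d₀)
  map_one' := by
    rw [Matrix.one_kronecker_one, Matrix.submatrix_one_equiv]
  map_mul' M N := by
    rw [Matrix.submatrix_mul_equiv]
    congr 1
    rw [← Matrix.mul_kronecker_mul, one_mul]
  map_zero' := by
    ext
    simp
  map_add' M N := by
    ext
    simp [add_mul]

lemma localEmbedding_apply (X : Finset Λ) (M : Matrix (X → Fin d₀) (X → Fin d₀) ℂ)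
    (σ τ : Λ → Fin d₀) :
    localEmbedding d₀ X M σ τ =
      M (fun i => σ i) (fun i => τ i) * (if ∀ i, i ∉ X → σ i = τ i then 1 else 0) := by
  have : (fun i : {i // i ∉ X} => σ i) = (fun i : {i // i ∉ X} => τ i) ↔
      ∀ i, i ∉ X → σ i = τ i := by
    simp [funext_iff]
  simp only [localEmbedding, RingHom.coe_mk, MonoidHom.coe_mk, OneHom.coe_mk,
    Matrix.submatrix_apply, Matrix.kroneckerMap_apply, Equiv.piEquivPiSubtypeProd_apply,
    Matrix.one_apply, this]

lemma supportedOn_iff {X : Finset Λ} {O : SpinOp Λ d₀} :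
    SupportedOn X O ↔ ∃ M, localEmbedding d₀ X M = O := by
  constructor
  · rintro ⟨M, hM⟩
    exact ⟨M, by ext σ τ; rw [localEmbedding_apply, hM]⟩
  · rintro ⟨M, rfl⟩
    exact ⟨M, localEmbedding_apply X M⟩

lemma SupportedOn.mul {X : Finset Λ} {O O' : SpinOp Λ d₀} (h : SupportedOn X O)
    (h' : SupportedOn X O') : SupportedOn X (O * O') := by
  rw [supportedOn_iff] at *
  obtain ⟨M, rfl⟩ := h
  obtain ⟨N, rfl⟩ := h'
  exact ⟨M * N, map_mul _ _ _⟩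

lemma SupportedOn.smul {X : Finset Λ} {O : SpinOp Λ d₀} (h : SupportedOn X O) (c : ℂ) :
    SupportedOn X (c • O) := by
  obtain ⟨M, hM⟩ := h
  exact ⟨c • M, fun σ τ => by simp [hM]⟩

lemma SupportedOn.sum {ι : Type*} {X : Finset Λ} {s : Finset ι} {f : ι → SpinOp Λ d₀}
    (h : ∀ i ∈ s, SupportedOn X (f i)) : SupportedOn X (∑ i ∈ s, f i) := by
  simp only [supportedOn_iff] at *
  choose! M hM using h
  exact ⟨∑ i ∈ s, M i, by rw [map_sum]; exact Finset.sum_congr rfl hM⟩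

lemma SupportedOn.mono {X Y : Finset Λ} (hXY : X ⊆ Y) {O : SpinOp Λ d₀}
    (h : SupportedOn X O) : SupportedOn Y O := by
  obtain ⟨M, hM⟩ := h
  refine ⟨fun σ τ => M (fun i => σ ⟨i, hXY i.2⟩) (fun i => τ ⟨i, hXY i.2⟩) *
    (if ∀ i : Y, (i : Λ) ∉ X → σ i = τ i then 1 else 0), fun σ τ => ?_⟩
  rw [hM, mul_assoc]
  congr 1
  by_cases h1 : ∀ i, i ∉ X → σ i = τ i
  · have h2 : ∀ i : Y, (i : Λ) ∉ X → σ i = τ i := fun i => h1 i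
    have h3 : ∀ i, i ∉ Y → σ i = τ i := fun i hi => h1 i fun h => hi (hXY h)
    rw [if_pos h1, if_pos h2, if_pos h3, one_mul]
  · rw [if_neg h1]
    by_cases h2 : ∀ i : Y, (i : Λ) ∉ X → σ i = τ i
    · have h3 : ¬ ∀ i, i ∉ Y → σ i = τ i := fun h3 => h1 fun i hi => by
        by_cases hY : i ∈ Y
        · exact h2 ⟨i, hY⟩ hi
        · exact h3 i hY
      rw [if_neg h3, mul_zero]
    · rw [if_neg h2, zero_mul]

lemma localEmbedding_mul_apply_of_disjoint {X Y : Finset Λ} (hXY : Disjoint X Y)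
    (M : Matrix (X → Fin d₀) (X → Fin d₀) ℂ) (N : Matrix (Y → Fin d₀) (Y → Fin d₀) ℂ)
    (σ τ : Λ → Fin d₀) :
    (localEmbedding d₀ X M * localEmbedding d₀ Y N) σ τ =
      M (fun i => σ i) (fun i => τ i) * N (fun i => σ i) (fun i => τ i) *
        (if ∀ i, i ∉ X → i ∉ Y → σ i = τ i then 1 else 0) := by
  have hd : ∀ i ∈ X, i ∉ Y := fun i hX hY => Finset.disjoint_left.1 hXY hX hY
  -- A contributing intermediate configuration agrees with σ off X and with τ off Y; as X and Y are
  -- disjoint, these conditions determine it.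
  rw [Matrix.mul_apply, Finset.sum_eq_single (fun i => if i ∈ X then τ i else σ i)]
  · rw [localEmbedding_apply, localEmbedding_apply]
    have h1 : (fun i : X => if (i : Λ) ∈ X then τ i else σ i) = fun i : X => τ i := by
      funext i; simp
    have h2 : (fun i : Y => if (i : Λ) ∈ X then τ i else σ i) = fun i : Y => σ i := by
      funext i; rw [if_neg fun h => hd _ h i.2]
    have h3 : (∀ i, i ∉ X → σ i = if i ∈ X then τ i else σ i) := by
      intro i hi; rw [if_neg hi]
    have h4 : (∀ i, i ∉ Y → (if i ∈ X then τ i else σ i) = τ i) ↔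
        ∀ i, i ∉ X → i ∉ Y → σ i = τ i := by
      refine forall_congr' fun i => ?_
      by_cases hi : i ∈ X <;> simp [hi]
    simp only [h1, h2, if_pos h3, h4]
    ring
  · intro ν _ hν
    rw [localEmbedding_apply, localEmbedding_apply]
    by_contra hne
    apply hν
    have ha : ∀ i, i ∉ X → σ i = ν i := by
      by_contra h; rw [if_neg h] at hne; simp at hne
    have hb : ∀ i, i ∉ Y → ν i = τ i := by
      by_contra h; rw [if_neg h] at hne; simp at hne
    funext i
    by_cases hi : i ∈ X
    · rw [if_pos hi, hb i (hd i hi)]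
    · rw [if_neg hi, ha i hi]
  · simp

/-- The explicit entries of the product of two operators on disjoint sets are symmetric in the two
factors. -/
lemma SupportedOn.commute {X Y : Finset Λ} (hXY : Disjoint X Y) {O O' : SpinOp Λ d₀}
    (h : SupportedOn X O) (h' : SupportedOn Y O') : Commute O O' := by
  rw [supportedOn_iff] at *
  obtain ⟨M, rfl⟩ := h
  obtain ⟨N, rfl⟩ := h'
  ext σ τ
  rw [localEmbedding_mul_apply_of_disjoint hXY, localEmbedding_mul_apply_of_disjoint hXY.symm,
    mul_comm (M _ _)]
  congr 2
  exact propext (forall_congr' fun i => ⟨fun h a b => h b a, fun h a b => h b a⟩)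

lemma SupportedOn.exp {X : Finset Λ} {O : SpinOp Λ d₀} (h : SupportedOn X O) :
    SupportedOn X (NormedSpace.exp O) := by
  rw [supportedOn_iff] at *
  obtain ⟨M, rfl⟩ := h
  let _ : NormedAlgebra ℚ (Matrix (X → Fin d₀) (X → Fin d₀) ℂ) :=
    NormedAlgebra.restrictScalars ℚ ℂ _
  refine ⟨NormedSpace.exp M, NormedSpace.map_exp (localEmbedding d₀ X) ?_ M⟩
  refine continuous_matrix fun σ τ => ?_
  simp only [localEmbedding_apply]
  fun_prop

end Support

/-! ### Unitary dynamics and the Duhamel estimate. -/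

section Evolution

variable {Λ : Type u} [Fintype Λ] [DecidableEq Λ] {d₀ : ℕ}

/-- The unitary group `exp (iHt)`. -/
noncomputable def propagator (H : SpinOp Λ d₀) (t : ℝ) : SpinOp Λ d₀ :=
  NormedSpace.exp ((Complex.I * (t : ℂ)) • H)

lemma timeEvolution_eq (H O : SpinOp Λ d₀) (t : ℝ) :
    timeEvolution H O t = propagator H t * O * propagator H (-t) := by
  simp [timeEvolution, propagator]

lemma propagator_zero (H : SpinOp Λ d₀) : propagator H 0 = 1 := by
  simp [propagator]

lemma propagator_add (H : SpinOp Λ d₀) (s t : ℝ) :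
    propagator H (s + t) = propagator H s * propagator H t := by
  unfold propagator
  let _ : NormedAlgebra ℚ (SpinOp Λ d₀) := NormedAlgebra.restrictScalars ℚ ℂ _
  rw [← NormedSpace.exp_add_of_commute, ← add_smul]
  · push_cast; ring_nf
  · exact ((Commute.refl H).smul_left _).smul_right _

lemma propagator_mul_neg (H : SpinOp Λ d₀) (t : ℝ) : propagator H t * propagator H (-t) = 1 := by
  rw [← propagator_add, add_neg_cancel, propagator_zero]

lemma propagator_neg_mul (H : SpinOp Λ d₀) (t : ℝ) : propagator H (-t) * propagator H t = 1 := by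
  rw [← propagator_add, neg_add_cancel, propagator_zero]

lemma star_propagator {H : SpinOp Λ d₀} (hH : H.IsHermitian) (t : ℝ) :
    star (propagator H t) = propagator H (-t) := by
  unfold propagator
  rw [NormedSpace.star_exp, star_smul, Matrix.star_eq_conjTranspose, hH.eq]
  simp

lemma propagator_mem_unitary {H : SpinOp Λ d₀} (hH : H.IsHermitian) (t : ℝ) :
    propagator H t ∈ unitary (SpinOp Λ d₀) := by
  rw [Unitary.mem_iff, star_propagator hH]
  exact ⟨propagator_neg_mul H t, propagator_mul_neg H t⟩

lemma norm_timeEvolution {H : SpinOp Λ d₀} (hH : H.IsHermitian) (O : SpinOp Λ d₀) (t : ℝ) :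
    ‖timeEvolution H O t‖ = ‖O‖ := by
  rw [timeEvolution_eq, CStarRing.norm_mul_mem_unitary _ (propagator_mem_unitary hH _),
    CStarRing.norm_mem_unitary_mul _ (propagator_mem_unitary hH _)]

lemma hasDerivAt_propagator (H : SpinOp Λ d₀) (t : ℝ) :
    HasDerivAt (propagator H) (propagator H t * (Complex.I • H)) t := by
  have h := hasDerivAt_exp_smul_const (𝕂 := ℝ) (Complex.I • H) t
  have e : (fun u : ℝ => NormedSpace.exp (u • Complex.I • H)) = propagator H := by
    funext u
    unfold propagator
    congr 1
    ext i j
    simp [mul_comm, mul_left_comm]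
  rw [e] at h
  refine h.congr_deriv ?_
  rw [← e]

lemma hasDerivAt_propagator' (H : SpinOp Λ d₀) (t : ℝ) :
    HasDerivAt (propagator H) (Complex.I • H * propagator H t) t := by
  refine (hasDerivAt_propagator H t).congr_deriv ?_
  exact (Commute.exp_right (((Commute.refl H).smul_left _).smul_right _)).eq.symm

lemma hasDerivAt_propagator_neg (H : SpinOp Λ d₀) (t : ℝ) :
    HasDerivAt (fun s => propagator H (-s)) (-(Complex.I • H * propagator H (-t))) t := by
  have h := (hasDerivAt_propagator' H (-t)).scomp t (hasDerivAt_neg t)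
  simpa [Function.comp_def] using h

/-- The one-step estimate: dropping the part `W` from the dynamics of `O`. -/
lemma norm_commutator_timeEvolution_le {H₀ W : SpinOp Λ d₀} (hH₀ : H₀.IsHermitian)
    (hW : W.IsHermitian) (O Y : SpinOp Λ d₀) {T : ℝ} (hT : 0 ≤ T) {B B' : ℝ → ℝ}
    (hB : ∀ t, HasDerivAt B (B' t) t)
    (bound : ∀ t, 0 ≤ t →
      ‖timeEvolution (H₀ + W) W t * Y - Y * timeEvolution (H₀ + W) W t‖ ≤ B' t) :
    ‖timeEvolution (H₀ + W) O T * Y - Y * timeEvolution (H₀ + W) O T‖ ≤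
      ‖timeEvolution H₀ O T * Y - Y * timeEvolution H₀ O T‖ + 2 * ‖O‖ * (B T - B 0) := by
  set H := H₀ + W with hHdef
  have hH : H.IsHermitian := hH₀.add hW
  set O' := timeEvolution H₀ O T with hO'
  -- Interaction picture: `U` and `V` are mutually inverse unitaries comparing the dynamics of H
  -- with that of H₀, and their derivatives involve only W evolved by H.
  let U : ℝ → SpinOp Λ d₀ := fun t => propagator H₀ t * propagator H (-t)
  let V : ℝ → SpinOp Λ d₀ := fun t => propagator H t * propagator H₀ (-t)
  have hVU : ∀ t, V t * U t = 1 := fun t => by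
    calc V t * U t = propagator H t * (propagator H₀ (-t) * propagator H₀ t) *
          propagator H (-t) := by simp only [U, V, mul_assoc]
      _ = 1 := by rw [propagator_neg_mul, mul_one, propagator_mul_neg]
  have hUmem : ∀ t, U t ∈ unitary (SpinOp Λ d₀) := fun t =>
    mul_mem (propagator_mem_unitary hH₀ _) (propagator_mem_unitary hH _)
  have hVmem : ∀ t, V t ∈ unitary (SpinOp Λ d₀) := fun t =>
    mul_mem (propagator_mem_unitary hH _) (propagator_mem_unitary hH₀ _)
  have hU : ∀ t, HasDerivAt U (-(Complex.I • (U t * timeEvolution H W t))) t := fun t => by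
    refine ((hasDerivAt_propagator H₀ t).mul (hasDerivAt_propagator_neg H t)).congr_deriv ?_
    have : timeEvolution H W t = propagator H t * (H - H₀) * propagator H (-t) := by
      rw [timeEvolution_eq, hHdef, add_sub_cancel_left]
    have e : U t * timeEvolution H W t =
        propagator H₀ t * (propagator H (-t) * propagator H t) * (H - H₀) *
          propagator H (-t) := by
      rw [this]; simp only [U, mul_assoc]
    rw [e, propagator_neg_mul]
    simp only [mul_one, mul_sub, sub_mul, smul_sub, Matrix.mul_smul, Matrix.smul_mul, mul_neg,
      mul_assoc]
    abel
  have hV : ∀ t, HasDerivAt V (Complex.I • (timeEvolution H W t * V t)) t := fun t => by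
    refine ((hasDerivAt_propagator H t).mul (hasDerivAt_propagator_neg H₀ t)).congr_deriv ?_
    have : timeEvolution H W t = propagator H t * (H - H₀) * propagator H (-t) := by
      rw [timeEvolution_eq, hHdef, add_sub_cancel_left]
    have e : timeEvolution H W t * V t =
        propagator H t * (H - H₀) * (propagator H (-t) * propagator H t) *
          propagator H₀ (-t) := by
      rw [this]; simp only [V, mul_assoc]
    rw [e, propagator_neg_mul]
    simp only [mul_one, mul_sub, sub_mul, smul_sub, Matrix.mul_smul, Matrix.smul_mul, mul_neg,
      mul_assoc]
    abel
  -- `f` interpolates between [O', Y] at time 0 and, up to unitary conjugation, the commutator with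
  -- the full dynamics at time T; its derivative is [O', g], and g is a unitarily rotated [W(t), Y].
  let f : ℝ → SpinOp Λ d₀ := fun t => O' * (U t * Y * V t) - U t * Y * V t * O'
  let g : ℝ → SpinOp Λ d₀ := fun t =>
    -(Complex.I • (U t * (timeEvolution H W t * Y - Y * timeEvolution H W t) * V t))
  have hP : ∀ t, HasDerivAt (fun t => U t * Y * V t) (g t) t := fun t => by
    refine (((hU t).mul_const Y).mul (hV t)).congr_deriv ?_
    simp only [g, mul_sub, sub_mul, smul_sub, Matrix.mul_smul, Matrix.smul_mul, neg_mul,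
      mul_assoc]
    abel
  have hg : ∀ t, 0 ≤ t → ‖g t‖ ≤ B' t := fun t ht => by
    simp only [g]
    rw [norm_neg, norm_smul, Complex.norm_I, one_mul,
      CStarRing.norm_mul_mem_unitary _ (hVmem t), CStarRing.norm_mem_unitary_mul _ (hUmem t)]
    exact bound t ht
  have hf : ∀ t, HasDerivAt f (O' * g t - g t * O') t := fun t =>
    ((hP t).const_mul O').sub ((hP t).mul_const O')
  have hO'n : ‖O'‖ = ‖O‖ := norm_timeEvolution hH₀ O T
  have key := image_norm_le_of_norm_deriv_right_le_deriv_boundary (f := f) (a := 0) (b := T)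
    (f' := fun t => O' * g t - g t * O')
    (B := fun t => ‖f 0‖ + 2 * ‖O‖ * (B t - B 0)) (B' := fun t => 2 * ‖O‖ * B' t)
    (fun t _ => (hf t).continuousAt.continuousWithinAt)
    (fun t _ => (hf t).hasDerivWithinAt) (by simp)
    (fun t => (((hB t).sub_const _).const_mul _).const_add _)
    (fun t ht => by
      have h1 := norm_mul_le O' (g t)
      have h2 := norm_mul_le (g t) O'
      have h3 := norm_sub_le (O' * g t) (g t * O')
      have h4 := mul_le_mul_of_nonneg_left (hg t ht.1) (norm_nonneg O)
      rw [hO'n] at h1 h2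
      nlinarith) (Set.right_mem_Icc.2 hT)
  have h0 : f 0 = O' * Y - Y * O' := by
    simp [f, U, V, propagator_zero]
  have hOT : timeEvolution H O T = V T * O' * U T := by
    have : V T * O' * U T = propagator H T * (propagator H₀ (-T) * propagator H₀ T) * O *
        (propagator H₀ (-T) * propagator H₀ T) * propagator H (-T) := by
      simp only [U, V, hO', timeEvolution_eq, mul_assoc]
    rw [this, propagator_neg_mul, mul_one, mul_one, timeEvolution_eq]
  have hUV : U T * V T = 1 := mul_eq_one_comm.1 (hVU T)
  have hfT : timeEvolution H O T * Y - Y * timeEvolution H O T = V T * f T * U T := by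
    have e1 : V T * f T * U T = V T * O' * U T * Y * (V T * U T) -
        (V T * U T) * Y * (V T * O' * U T) := by
      simp only [f, mul_sub, sub_mul, mul_assoc]
    rw [e1, hVU, hOT, mul_one, one_mul]
  rw [hfT, CStarRing.norm_mul_mem_unitary _ (hUmem T), CStarRing.norm_mem_unitary_mul _ (hVmem T),
    ← h0]
  exact key

end Evolution

/-! ### Growth of commutators through boundary-crossing terms. -/

section LiebRobinson

lemma isHermitian_sum {n ι : Type*} (s : Finset ι) {f : ι → Matrix n n ℂ}
    (hf : ∀ i, (f i).IsHermitian) : (∑ i ∈ s, f i).IsHermitian := by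
  rw [Matrix.IsHermitian, Matrix.conjTranspose_sum]
  exact Finset.sum_congr rfl fun i _ => (hf i).eq

variable {Λ : Type u} [Fintype Λ] [DecidableEq Λ] {d₀ : ℕ}

/-- The sets that meet both `X` and its complement. -/
def crossing (X : Finset Λ) : Finset (Finset Λ) :=
  Finset.univ.filter fun Z => ¬ Z ⊆ X ∧ ¬ Disjoint Z X

/-- The strength of the interaction between two sites. -/
noncomputable def pairStrength (h : Finset Λ → SpinOp Λ d₀) (i j : Λ) : ℝ :=
  ∑ Z with i ∈ Z ∧ j ∈ Z, ‖h Z‖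

lemma timeEvolution_sum {ι : Type*} (H : SpinOp Λ d₀) (s : Finset ι) (f : ι → SpinOp Λ d₀)
    (t : ℝ) : timeEvolution H (∑ i ∈ s, f i) t = ∑ i ∈ s, timeEvolution H (f i) t := by
  simp [timeEvolution, Finset.mul_sum, Finset.sum_mul]

/-- A dynamics without terms crossing the boundary of `X` preserves the operators on `X`. -/
lemma SupportedOn.timeEvolution_of_no_crossing {h : Finset Λ → SpinOp Λ d₀}
    (hs : ∀ Z, SupportedOn Z (h Z)) {X : Finset Λ} {O : SpinOp Λ d₀} (hO : SupportedOn X O)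
    (t : ℝ) : SupportedOn X (timeEvolution (∑ Z ∈ (crossing X)ᶜ, h Z) O t) := by
  let _ : NormedAlgebra ℚ (SpinOp Λ d₀) := NormedAlgebra.restrictScalars ℚ ℂ _
  set Hin : SpinOp Λ d₀ := ∑ Z ∈ (crossing X)ᶜ with Z ⊆ X, h Z
  set Hout : SpinOp Λ d₀ := ∑ Z ∈ (crossing X)ᶜ with ¬ Z ⊆ X, h Z
  have hsum : ∑ Z ∈ (crossing X)ᶜ, h Z = Hin + Hout :=
    (Finset.sum_filter_add_sum_filter_not _ _ _).symm
  have hin : SupportedOn X Hin := SupportedOn.sum fun Z hZ =>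
    (hs Z).mono (Finset.mem_filter.1 hZ).2
  have hout : SupportedOn Xᶜ Hout := SupportedOn.sum fun Z hZ => by
    refine (hs Z).mono ?_
    simp only [crossing, Finset.mem_filter, Finset.mem_compl, Finset.mem_univ, true_and] at hZ
    have hd : Disjoint Z X := by
      by_contra hd
      exact hZ.1 ⟨hZ.2, hd⟩
    exact fun i hi => Finset.mem_compl.2 (Finset.disjoint_left.1 hd hi)
  have hdisj : Disjoint X Xᶜ := disjoint_compl_right
  have hsplit : ∀ s, propagator (Hin + Hout) s = propagator Hin s * propagator Hout s := by
    intro s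
    unfold propagator
    rw [smul_add, NormedSpace.exp_add_of_commute]
    exact (((hin.commute hdisj hout).smul_left _).smul_right _)
  have hcomm : Commute (propagator Hout t) O :=
    ((hout.smul _).exp.commute hdisj.symm hO)
  have hcomm' : Commute (propagator Hout (-t)) (propagator Hin (-t)) :=
    ((hout.smul _).exp.commute hdisj.symm (hin.smul _).exp)
  have : timeEvolution (∑ Z ∈ (crossing X)ᶜ, h Z) O t =
      propagator Hin t * O * propagator Hin (-t) := by
    rw [timeEvolution_eq, hsum, hsplit, hsplit, ← hcomm'.eq]
    calc propagator Hin t * propagator Hout t * O * (propagator Hout (-t) * propagator Hin (-t))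
        = propagator Hin t * (propagator Hout t * O) * propagator Hout (-t) *
          propagator Hin (-t) := by simp only [mul_assoc]
      _ = propagator Hin t * O * (propagator Hout t * propagator Hout (-t)) *
          propagator Hin (-t) := by rw [hcomm.eq]; simp only [mul_assoc]
      _ = _ := by rw [propagator_mul_neg, mul_one]
  rw [this]
  exact ((hin.smul _).exp.mul hO).mul (hin.smul _).exp

/-- Only the terms crossing the boundary of the support contribute to the growth of a
commutator. -/
lemma exists_norm_commutator_le {h : Finset Λ → SpinOp Λ d₀} (hh : ∀ Z, (h Z).IsHermitian)
    (hs : ∀ Z, SupportedOn Z (h Z)) {X : Finset Λ} {O : SpinOp Λ d₀} (hO : SupportedOn X O)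
    (Y : SpinOp Λ d₀) {T : ℝ} (hT : 0 ≤ T) {B B' : ℝ → ℝ} (hB : ∀ t, HasDerivAt B (B' t) t)
    (bound : ∀ t, 0 ≤ t → ∑ Z ∈ crossing X,
      ‖timeEvolution (hamiltonian h) (h Z) t * Y - Y * timeEvolution (hamiltonian h) (h Z) t‖
        ≤ B' t) :
    ∃ O' : SpinOp Λ d₀, SupportedOn X O' ∧ ‖O'‖ = ‖O‖ ∧
      ‖timeEvolution (hamiltonian h) O T * Y - Y * timeEvolution (hamiltonian h) O T‖ ≤
        ‖O' * Y - Y * O'‖ + 2 * ‖O‖ * (B T - B 0) := by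
  have hH : hamiltonian h = ∑ Z ∈ (crossing X)ᶜ, h Z + ∑ Z ∈ crossing X, h Z := by
    rw [hamiltonian, Finset.sum_compl_add_sum]
  refine ⟨timeEvolution (∑ Z ∈ (crossing X)ᶜ, h Z) O T, hO.timeEvolution_of_no_crossing hs T,
    norm_timeEvolution (isHermitian_sum _ hh) _ _, ?_⟩
  rw [hH]
  refine norm_commutator_timeEvolution_le (isHermitian_sum _ hh) (isHermitian_sum _ hh) O Y hT hB
    fun t ht => ?_
  rw [← hH, timeEvolution_sum, Finset.sum_mul, Finset.mul_sum, ← Finset.sum_sub_distrib]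
  exact (norm_sum_le _ _).trans (bound t ht)

/-- A crossing set contains some l in X, so its norm is counted in the strength of each pair (l, m)
with m in the set. This forgets the boundary, but the result is again a sum over the support, which
is what an iteration needs. -/
lemma sum_crossing_le_sum_pairStrength (h : Finset Λ → SpinOp Λ d₀) (X : Finset Λ) {u : Λ → ℝ}
    (hu : ∀ i, 0 ≤ u i) :
    ∑ Z ∈ crossing X, ‖h Z‖ * ∑ m ∈ Z, u m ≤ ∑ l ∈ X, ∑ m, pairStrength h l m * u m := by
  calc ∑ Z ∈ crossing X, ‖h Z‖ * ∑ m ∈ Z, u m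
      ≤ ∑ Z, ∑ l ∈ X, ∑ m, (if l ∈ Z ∧ m ∈ Z then ‖h Z‖ else 0) * u m := by
        refine (Finset.sum_le_sum fun Z hZ => ?_).trans
          (Finset.sum_le_sum_of_subset_of_nonneg (Finset.subset_univ (crossing X)) fun Z _ _ =>
            Finset.sum_nonneg fun l _ => Finset.sum_nonneg fun m _ =>
              mul_nonneg (by split_ifs <;> positivity) (hu m))
        simp only [crossing, Finset.mem_filter, Finset.mem_univ, true_and] at hZ
        obtain ⟨l, hlZ, hlX⟩ := Finset.not_disjoint_iff.1 hZ.2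
        refine le_trans (le_of_eq ?_) (Finset.single_le_sum (f := fun l => ∑ m,
          (if l ∈ Z ∧ m ∈ Z then ‖h Z‖ else 0) * u m) (fun l _ => Finset.sum_nonneg fun m _ =>
            mul_nonneg (by split_ifs <;> positivity) (hu m)) hlX)
        simp only [hlZ, true_and, ite_mul, zero_mul]
        rw [Finset.mul_sum, Finset.sum_ite_mem, Finset.univ_inter]
    _ = ∑ l ∈ X, ∑ m, pairStrength h l m * u m := by
        rw [Finset.sum_comm]
        refine Finset.sum_congr rfl fun l _ => ?_
        rw [Finset.sum_comm]
        refine Finset.sum_congr rfl fun m _ => ?_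
        rw [pairStrength, ← Finset.sum_mul, Finset.sum_filter]

/-- A crossing set has a site a in X and a site b outside. Charge each of its sites m in X to the
pair (m, b), and each m outside X to (a, m). Only pairs across the boundary occur, which is what
later produces the surface of X. -/
lemma sum_crossing_le_sum_boundary_pairs (h : Finset Λ → SpinOp Λ d₀) (X : Finset Λ)
    {u : Λ → ℝ} (hu : ∀ i, 0 ≤ u i) :
    ∑ Z ∈ crossing X, ‖h Z‖ * ∑ m ∈ Z, u m ≤
      ∑ i ∈ X, ∑ j ∈ Xᶜ, pairStrength h i j * (u i + u j) := by
  have hnn : ∀ (Z : Finset Λ) (i j : Λ), 0 ≤ (if i ∈ Z ∧ j ∈ Z then ‖h Z‖ else 0) * (u i + u j) :=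
    fun Z i j => mul_nonneg (by split_ifs <;> positivity) (add_nonneg (hu i) (hu j))
  calc ∑ Z ∈ crossing X, ‖h Z‖ * ∑ m ∈ Z, u m
      ≤ ∑ Z, ∑ i ∈ X, ∑ j ∈ Xᶜ, (if i ∈ Z ∧ j ∈ Z then ‖h Z‖ else 0) * (u i + u j) := by
        refine (Finset.sum_le_sum fun Z hZ => ?_).trans
          (Finset.sum_le_sum_of_subset_of_nonneg (Finset.subset_univ (crossing X)) fun Z _ _ =>
            Finset.sum_nonneg fun i _ => Finset.sum_nonneg fun j _ => hnn Z i j)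
        simp only [crossing, Finset.mem_filter, Finset.mem_univ, true_and] at hZ
        obtain ⟨a, haZ, haX⟩ := Finset.not_disjoint_iff.1 hZ.2
        obtain ⟨b, hbZ, hbX⟩ := Finset.not_subset.1 hZ.1
        have hin : ∑ i ∈ X, (if i ∈ Z then ‖h Z‖ * u i else 0) = ‖h Z‖ * ∑ m ∈ Z ∩ X, u m := by
          rw [Finset.sum_ite_mem, Finset.mul_sum, Finset.inter_comm]
        have hout : ∑ j ∈ Xᶜ, (if j ∈ Z then ‖h Z‖ * u j else 0) =
            ‖h Z‖ * ∑ m ∈ Z \ X, u m := by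
          rw [Finset.sum_ite_mem, Finset.mul_sum]
          refine Finset.sum_congr ?_ fun _ _ => rfl
          ext i
          simp [and_comm]
        have hadd : ‖h Z‖ * ∑ m ∈ Z, u m =
            ∑ i ∈ X, (if i ∈ Z then ‖h Z‖ * u i else 0) +
              ∑ j ∈ Xᶜ, (if j ∈ Z then ‖h Z‖ * u j else 0) := by
          rw [hin, hout, ← mul_add, Finset.sum_inter_add_sum_sdiff]
        have hsplit : ∑ i ∈ X, ∑ j ∈ Xᶜ, (if i ∈ Z ∧ j ∈ Z then ‖h Z‖ else 0) * (u i + u j) =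
            ∑ i ∈ X, ∑ j ∈ Xᶜ, (if i ∈ Z ∧ j ∈ Z then ‖h Z‖ * u i else 0) +
            ∑ i ∈ X, ∑ j ∈ Xᶜ, (if i ∈ Z ∧ j ∈ Z then ‖h Z‖ * u j else 0) := by
          rw [← Finset.sum_add_distrib]
          refine Finset.sum_congr rfl fun i _ => ?_
          rw [← Finset.sum_add_distrib]
          refine Finset.sum_congr rfl fun j _ => ?_
          split_ifs <;> ring
        rw [hadd, hsplit]
        refine add_le_add (Finset.sum_le_sum fun i _ => ?_) ?_
        · refine le_trans (le_of_eq ?_) (Finset.single_le_sum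
            (f := fun j => if i ∈ Z ∧ j ∈ Z then ‖h Z‖ * u i else 0)
            (fun j _ => ?_) (Finset.mem_compl.2 hbX))
          · simp [hbZ]
          · split_ifs
            · exact mul_nonneg (norm_nonneg _) (hu i)
            · exact le_rfl
        · refine le_trans (le_of_eq ?_) (Finset.single_le_sum
            (f := fun i => ∑ j ∈ Xᶜ, if i ∈ Z ∧ j ∈ Z then ‖h Z‖ * u j else 0)
            (fun i _ => Finset.sum_nonneg fun j _ => ?_) haX)
          · simp [haZ]
          · split_ifs
            · exact mul_nonneg (norm_nonneg _) (hu j)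
            · exact le_rfl
    _ = ∑ i ∈ X, ∑ j ∈ Xᶜ, pairStrength h i j * (u i + u j) := by
        rw [Finset.sum_comm]
        refine Finset.sum_congr rfl fun i _ => ?_
        rw [Finset.sum_comm]
        refine Finset.sum_congr rfl fun j _ => ?_
        rw [pairStrength, ← Finset.sum_mul, Finset.sum_filter]

lemma norm_commutator_le (O Y : SpinOp Λ d₀) : ‖O * Y - Y * O‖ ≤ 2 * ‖O‖ * ‖Y‖ := by
  have h1 := norm_mul_le O Y
  have h2 := norm_mul_le Y O
  have h3 := norm_sub_le (O * Y) (Y * O)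
  nlinarith

/-! ### Iterating the Duhamel estimate with site weights. -/

section Iteration

variable {h : Finset Λ → SpinOp Λ d₀} {a : Λ → ℝ} {K : ℝ} {Y : Finset Λ} {OY : SpinOp Λ d₀}

/-- The term with a is a fixed point of the Duhamel recursion because J a ≤ K a. The trivial bound
that starts the recursion is integrated once per step, using J 1 ≤ K, and becomes a vanishing
remainder. -/
lemma norm_commutator_iterate_le (hh : ∀ Z, (h Z).IsHermitian)
    (hs : ∀ Z, SupportedOn Z (h Z)) (ha : ∀ i, 0 ≤ a i) (haY : ∀ i ∈ Y, 1 ≤ a i) (hK : 0 ≤ K)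
    (hKa : ∀ l, ∑ m, pairStrength h l m * a m ≤ K * a l) (hK1 : ∀ l, ∑ m, pairStrength h l m ≤ K)
    (hOY : SupportedOn Y OY) (hOY1 : ‖OY‖ = 1) (n : ℕ) :
    ∀ (Z : Finset Λ) (O : SpinOp Λ d₀), SupportedOn Z O → ∀ t : ℝ, 0 ≤ t →
      ‖timeEvolution (hamiltonian h) O t * OY - OY * timeEvolution (hamiltonian h) O t‖ ≤
        ‖O‖ * ∑ l ∈ Z, (2 * exp (2 * K * t) * a l + 2 * ((2 * K * t) ^ n / n.factorial)) := by
  have hH : (hamiltonian h).IsHermitian := isHermitian_sum _ hh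
  induction n with
  | zero =>
    intro Z O hO t ht
    -- For empty support the sum on the right is 0, so the trivial bound fails; such an operator has
    -- no crossing terms and stays in the commutant of O_Y.
    rcases Z.eq_empty_or_nonempty with rfl | hZ
    · obtain ⟨O', hO', -, hle⟩ := exists_norm_commutator_le hh hs hO OY ht
        (B := fun _ => 0) (B' := fun _ => 0) (fun t => hasDerivAt_const t 0)
        (fun t _ => by simp [crossing])
      rw [((hO'.commute (Finset.disjoint_empty_left Y) hOY).eq)] at hle
      simpa using hle
    · have h1 := norm_commutator_le (timeEvolution (hamiltonian h) O t) OY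
      rw [norm_timeEvolution hH, hOY1, mul_one, mul_comm] at h1
      refine h1.trans (mul_le_mul_of_nonneg_left ?_ (norm_nonneg _))
      obtain ⟨l, hl⟩ := hZ
      have hnn : ∀ i, 0 ≤ 2 * exp (2 * K * t) * a i := fun i =>
        mul_nonneg (by positivity) (ha i)
      refine le_trans ?_ (Finset.single_le_sum (f := fun l => 2 * exp (2 * K * t) * a l +
        2 * ((2 * K * t) ^ 0 / (Nat.factorial 0 : ℝ))) (fun i _ => ?_) hl)
      · simpa using hnn l
      · exact add_nonneg (hnn i) (by positivity)
  | succ n ih =>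
    intro Z O hO t ht
    let u : ℝ → Λ → ℝ := fun s l =>
      2 * exp (2 * K * s) * a l + 2 * ((2 * K * s) ^ n / n.factorial)
    have hu : ∀ s, 0 ≤ s → ∀ l, 0 ≤ u s l := fun s hs' l =>
      add_nonneg (mul_nonneg (by positivity) (ha l)) (by positivity)
    -- An antiderivative of K ∑ u, the bound on the crossing terms given by the induction
    -- hypothesis.
    let B : ℝ → ℝ := fun s => ∑ l ∈ Z, (exp (2 * K * s) * a l +
      (2 * K * s) ^ (n + 1) / (n + 1).factorial)
    have hB : ∀ s, HasDerivAt B (∑ l ∈ Z, K * u s l) s := fun s => by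
      refine HasDerivAt.fun_sum fun l _ => ?_
      have h1 : HasDerivAt (fun s : ℝ => 2 * K * s) (2 * K) s := by
        simpa using (hasDerivAt_id s).const_mul (2 * K)
      have h2 := (h1.exp.mul_const (a l)).add ((h1.pow (n + 1)).div_const ((n + 1).factorial : ℝ))
      refine h2.congr_deriv ?_
      simp only [u, Nat.factorial_succ]
      push_cast
      have : (n.factorial : ℝ) ≠ 0 := by positivity
      have : (n + 1 : ℝ) ≠ 0 := by positivity
      field_simp
    obtain ⟨O', hO', hn, hle⟩ := exists_norm_commutator_le hh hs hO OY ht hB (fun s hs0 => by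
      calc _ ≤ ∑ Z' ∈ crossing Z, ‖h Z'‖ * ∑ m ∈ Z', u s m :=
            Finset.sum_le_sum fun Z' _ => ih Z' (h Z') (hs Z') s hs0
        _ ≤ ∑ l ∈ Z, ∑ m, pairStrength h l m * u s m :=
            sum_crossing_le_sum_pairStrength h Z (hu s hs0)
        _ ≤ ∑ l ∈ Z, K * u s l := by
            refine Finset.sum_le_sum fun l _ => ?_
            have e : ∑ m, pairStrength h l m * u s m =
                2 * exp (2 * K * s) * ∑ m, pairStrength h l m * a m +
                  2 * ((2 * K * s) ^ n / n.factorial) * ∑ m, pairStrength h l m := by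
              rw [Finset.mul_sum, Finset.mul_sum, ← Finset.sum_add_distrib]
              exact Finset.sum_congr rfl fun m _ => by simp only [u]; ring
            rw [e]
            have h1 := mul_le_mul_of_nonneg_left (hKa l)
              (show 0 ≤ 2 * exp (2 * K * s) by positivity)
            have h2 := mul_le_mul_of_nonneg_left (hK1 l)
              (show 0 ≤ 2 * ((2 * K * s) ^ n / n.factorial) by positivity)
            simp only [u]
            linarith)
    -- The commutator vanishes unless Z meets Y, and then a common site has weight at least 1.
    have h0 : ‖O' * OY - OY * O'‖ ≤ ‖O‖ * ∑ l ∈ Z, 2 * a l := by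
      by_cases hd : Disjoint Z Y
      · rw [(hO'.commute hd hOY).eq, sub_self, norm_zero]
        exact mul_nonneg (norm_nonneg _) (Finset.sum_nonneg fun l _ => by linarith [ha l])
      · have h1 := norm_commutator_le O' OY
        rw [hn, hOY1, mul_one, mul_comm] at h1
        refine h1.trans (mul_le_mul_of_nonneg_left ?_ (norm_nonneg _))
        obtain ⟨l, hlZ, hlY⟩ := Finset.not_disjoint_iff.1 hd
        refine le_trans ?_ (Finset.single_le_sum (f := fun l => 2 * a l)
          (fun i _ => by linarith [ha i]) hlZ)
        linarith [haY l hlY]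
    refine hle.trans ?_
    have hBe : B t - B 0 = ∑ l ∈ Z, ((exp (2 * K * t) - 1) * a l +
        (2 * K * t) ^ (n + 1) / (n + 1).factorial) := by
      simp only [B]
      rw [← Finset.sum_sub_distrib]
      refine Finset.sum_congr rfl fun l _ => ?_
      simp
      ring
    rw [hBe]
    have e : ‖O‖ * ∑ l ∈ Z, (2 * exp (2 * K * t) * a l +
        2 * ((2 * K * t) ^ (n + 1) / (n + 1).factorial)) =
        ‖O‖ * ∑ l ∈ Z, 2 * a l + 2 * ‖O‖ * ∑ l ∈ Z, ((exp (2 * K * t) - 1) * a l +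
          (2 * K * t) ^ (n + 1) / (n + 1).factorial) := by
      simp only [Finset.mul_sum]
      rw [← Finset.sum_add_distrib]
      exact Finset.sum_congr rfl fun l _ => by ring
    rw [e]
    linarith

lemma norm_commutator_le_sum_weights (hh : ∀ Z, (h Z).IsHermitian)
    (hs : ∀ Z, SupportedOn Z (h Z)) (ha : ∀ i, 0 ≤ a i) (haY : ∀ i ∈ Y, 1 ≤ a i) (hK : 0 ≤ K)
    (hKa : ∀ l, ∑ m, pairStrength h l m * a m ≤ K * a l) (hK1 : ∀ l, ∑ m, pairStrength h l m ≤ K)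
    (hOY : SupportedOn Y OY) (hOY1 : ‖OY‖ = 1) {Z : Finset Λ} {O : SpinOp Λ d₀}
    (hO : SupportedOn Z O) {t : ℝ} (ht : 0 ≤ t) :
    ‖timeEvolution (hamiltonian h) O t * OY - OY * timeEvolution (hamiltonian h) O t‖ ≤
      ‖O‖ * ∑ l ∈ Z, 2 * exp (2 * K * t) * a l := by
  refine ge_of_tendsto' (x := Filter.atTop) ?_ fun n =>
    norm_commutator_iterate_le hh hs ha haY hK hKa hK1 hOY hOY1 n Z O hO t ht
  refine Filter.Tendsto.const_mul _ (tendsto_finsetSum _ fun l _ => ?_)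
  have := (FloorSemiring.tendsto_pow_div_factorial_atTop (2 * K * t)).const_mul 2
  simpa using this.const_add (2 * exp (2 * K * t) * a l)

/-- One more Duhamel step, fed with the closed bound for the crossing terms. Since X and Y are
disjoint the initial commutator is zero, which leaves the factor exp(2Kt) - 1. -/
lemma norm_commutator_le_boundary_pairs (hh : ∀ Z, (h Z).IsHermitian)
    (hs : ∀ Z, SupportedOn Z (h Z)) (ha : ∀ i, 0 ≤ a i) (haY : ∀ i ∈ Y, 1 ≤ a i) (hK : 0 < K)
    (hKa : ∀ l, ∑ m, pairStrength h l m * a m ≤ K * a l) (hK1 : ∀ l, ∑ m, pairStrength h l m ≤ K)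
    (hOY : SupportedOn Y OY) (hOY1 : ‖OY‖ = 1) {X : Finset Λ} {O : SpinOp Λ d₀}
    (hO : SupportedOn X O) (hXY : Disjoint X Y) {t : ℝ} (ht : 0 ≤ t) :
    ‖timeEvolution (hamiltonian h) O t * OY - OY * timeEvolution (hamiltonian h) O t‖ ≤
      2 / K * ‖O‖ * (exp (2 * K * t) - 1) *
        ∑ i ∈ X, ∑ j ∈ Xᶜ, pairStrength h i j * (a i + a j) := by
  set P := ∑ i ∈ X, ∑ j ∈ Xᶜ, pairStrength h i j * (a i + a j)
  have hB : ∀ s, HasDerivAt (fun s : ℝ => exp (2 * K * s) * (P / K)) (2 * exp (2 * K * s) * P) s := by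
    intro s
    have h1 : HasDerivAt (fun s : ℝ => 2 * K * s) (2 * K) s := by
      simpa using (hasDerivAt_id s).const_mul (2 * K)
    refine (h1.exp.mul_const (P / K)).congr_deriv ?_
    field_simp
  obtain ⟨O', hO', hn, hle⟩ := exists_norm_commutator_le hh hs hO OY ht hB (fun s hs0 => by
    calc _ ≤ ∑ Z ∈ crossing X, ‖h Z‖ * ∑ l ∈ Z, 2 * exp (2 * K * s) * a l :=
          Finset.sum_le_sum fun Z _ =>
            norm_commutator_le_sum_weights hh hs ha haY hK.le hKa hK1 hOY hOY1 (hs Z) hs0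
      _ = 2 * exp (2 * K * s) * ∑ Z ∈ crossing X, ‖h Z‖ * ∑ l ∈ Z, a l := by
          rw [Finset.mul_sum]
          refine Finset.sum_congr rfl fun Z _ => ?_
          rw [← Finset.mul_sum]
          ring
      _ ≤ 2 * exp (2 * K * s) * P :=
          mul_le_mul_of_nonneg_left (sum_crossing_le_sum_boundary_pairs h X ha) (by positivity))
  rw [(hO'.commute hXY hOY).eq, sub_self, norm_zero, zero_add] at hle
  refine hle.trans (le_of_eq ?_)
  simp only [mul_zero, exp_zero]
  ring

end Iteration

end LiebRobinson

/-! ### Distances, surfaces and exponential sums on the lattice. -/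

section GeometryLemmas

variable {Λ : Type u} {G : SimpleGraph Λ}

lemma siteDist_le_dist {X Y : Finset Λ} {x y : Λ} (hx : x ∈ X) (hy : y ∈ Y) :
    siteDist G X Y ≤ G.dist x y :=
  Nat.sInf_le ⟨x, hx, y, hy, rfl⟩

lemma exists_dist_eq_siteDist {X Y : Finset Λ} (hX : X.Nonempty) (hY : Y.Nonempty) :
    ∃ x ∈ X, ∃ y ∈ Y, G.dist x y = siteDist G X Y := by
  obtain ⟨x, hx⟩ := hX
  obtain ⟨y, hy⟩ := hY
  exact Nat.sInf_mem (s := {n : ℕ | ∃ x ∈ X, ∃ y ∈ Y, G.dist x y = n}) ⟨_, x, hx, y, hy, rfl⟩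

lemma siteDist_comm (X Y : Finset Λ) : siteDist G X Y = siteDist G Y X := by
  unfold siteDist
  congr 1
  ext n
  constructor <;> rintro ⟨x, hx, y, hy, h⟩ <;> exact ⟨y, hy, x, hx, by rw [G.dist_comm, h]⟩

lemma siteDist_le_dist_add (hG : G.Connected) {X Y : Finset Λ} (hY : Y.Nonempty) {x : Λ}
    (hx : x ∈ X) (m : Λ) : siteDist G X Y ≤ G.dist x m + siteDist G {m} Y := by
  obtain ⟨m', hm', y, hy, h⟩ := exists_dist_eq_siteDist (G := G) (Finset.singleton_nonempty m) hY
  rw [Finset.mem_singleton] at hm'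
  subst hm'
  rw [← h]
  exact (siteDist_le_dist hx hy).trans hG.dist_triangle

lemma disjoint_of_siteDist_pos {X Y : Finset Λ} (h : 0 < siteDist G X Y) : Disjoint X Y := by
  rw [Finset.disjoint_left]
  intro i hX hY
  have := siteDist_le_dist (G := G) hX hY
  simp at this
  omega

variable [Fintype Λ] [DecidableEq Λ]

lemma mem_surface_of_adj (hG : G.Connected) {X : Finset Λ} {i j : Λ} (hi : i ∈ X) (hj : j ∉ X)
    (hij : G.Adj i j) : i ∈ surface G X := by
  refine Finset.mem_filter.2 ⟨hi, ?_⟩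
  have hjc : j ∈ Xᶜ := Finset.mem_compl.2 hj
  have h1 : siteDist G {i} Xᶜ ≤ 1 :=
    (siteDist_le_dist (Finset.mem_singleton_self i) hjc).trans
      (SimpleGraph.dist_eq_one_iff_adj.2 hij).le
  obtain ⟨i', hi', y, hy, h⟩ :=
    exists_dist_eq_siteDist (G := G) (Finset.singleton_nonempty i) ⟨j, hjc⟩
  rw [Finset.mem_singleton] at hi'
  subst hi'
  have h2 : 0 < G.dist i' y := hG.pos_dist_of_ne fun e => Finset.mem_compl.1 hy (e ▸ hi)
  omega

/-- The last site before a first exit of the walk from X lies on the surface and splits the walk. -/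
lemma exists_mem_surface_of_walk (hG : G.Connected) {X : Finset Λ} {i j : Λ} (p : G.Walk i j)
    (hi : i ∈ X) (hj : j ∉ X) : ∃ s ∈ surface G X, G.dist i s + G.dist s j ≤ p.length := by
  induction p with
  | nil => exact absurd hi hj
  | cons hadj p ih =>
    rename_i a b c
    by_cases hb : b ∈ X
    · obtain ⟨s, hs, h⟩ := ih hb hj
      refine ⟨s, hs, ?_⟩
      have h1 : G.dist a s ≤ G.dist a b + G.dist b s := hG.dist_triangle
      rw [SimpleGraph.dist_eq_one_iff_adj.2 hadj] at h1
      rw [SimpleGraph.Walk.length_cons]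
      omega
    · refine ⟨a, mem_surface_of_adj hG hi hb hadj, ?_⟩
      rw [SimpleGraph.dist_self, zero_add]
      exact SimpleGraph.dist_le _

lemma exists_mem_surface_dist_add_le (hG : G.Connected) {X : Finset Λ} {i j : Λ}
    (hi : i ∈ X) (hj : j ∉ X) : ∃ s ∈ surface G X, G.dist i s + G.dist s j ≤ G.dist i j := by
  obtain ⟨p, hp⟩ := hG.exists_walk_length_eq_dist i j
  rw [← hp]
  exact exists_mem_surface_of_walk hG p hi hj

lemma one_le_card_surface (hG : G.Connected) {X : Finset Λ} (hX : X.Nonempty)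
    (hX' : X ≠ Finset.univ) : 1 ≤ (surface G X).card := by
  obtain ⟨i, hi⟩ := hX
  obtain ⟨j, hj⟩ : ∃ j, j ∉ X := by
    by_contra! h
    exact hX' (Finset.eq_univ_iff_forall.2 h)
  obtain ⟨s, hs, -⟩ := exists_mem_surface_dist_add_le hG hi hj
  exact Finset.card_pos.2 ⟨s, hs⟩

/-- A bound for `∑ j, exp (-ν d_{i,j})` on a lattice of dimension `D`. -/
noncomputable def latticeSum (D : ℕ) (γ ν : ℝ) : ℝ :=
  ∑' n : ℕ, γ * ((n + 1 : ℕ) : ℝ) ^ D * exp (-ν * n)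

lemma summable_latticeSum (D : ℕ) (γ : ℝ) {ν : ℝ} (hν : 0 < ν) :
    Summable fun n : ℕ => γ * ((n + 1 : ℕ) : ℝ) ^ D * exp (-ν * n) := by
  have h := ((summable_nat_add_iff 1).2
    (Real.summable_pow_mul_exp_neg_nat_mul D hν)).mul_left (γ * exp ν)
  refine h.congr fun n => ?_
  have : exp (-ν * n) = exp ν * exp (-ν * ((n + 1 : ℕ) : ℝ)) := by
    rw [← exp_add]; congr 1; push_cast; ring
  rw [this]
  ring

lemma latticeSum_pos (D : ℕ) {γ ν : ℝ} (hγ : 1 ≤ γ) (hν : 0 < ν) : 0 < latticeSum D γ ν :=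
  (summable_latticeSum D γ hν).tsum_pos (fun n => by positivity) 0 (by positivity)

lemma sum_exp_dist_le_latticeSum {D : ℕ} {γ ν : ℝ} (hγ : 1 ≤ γ) (hν : 0 < ν)
    (hL : IsLattice G D γ) (i : Λ) :
    ∑ j, exp (-ν * (G.dist i j : ℝ)) ≤ latticeSum D γ ν := by
  rw [← Finset.sum_fiberwise_of_maps_to (t := Finset.univ.image (G.dist i))
    (g := G.dist i) (fun j _ => Finset.mem_image_of_mem _ (Finset.mem_univ j))]
  refine le_trans (Finset.sum_le_sum fun n _ => ?_)
    ((summable_latticeSum D γ hν).sum_le_tsum _ fun n _ => by positivity)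
  have h1 : ∑ j with G.dist i j = n, exp (-ν * (G.dist i j : ℝ)) =
      ((Finset.univ.filter fun j => G.dist i j = n).card : ℝ) * exp (-ν * n) := by
    rw [← nsmul_eq_mul, ← Finset.sum_const]
    refine Finset.sum_congr rfl fun j hj => ?_
    rw [(Finset.mem_filter.1 hj).2]
  rw [h1]
  refine mul_le_mul_of_nonneg_right ?_ (exp_pos _).le
  -- Radius n + 1 rather than n, because the volume bound needs radius at least 1 and n may be 0.
  refine le_trans ?_ (hL.ball_le i ((n + 1 : ℕ) : ℝ) (by push_cast; linarith [n.cast_nonneg (α := ℝ)]))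
  refine Nat.cast_le.2 (Finset.card_le_card fun j hj => ?_)
  refine Finset.mem_filter.2 ⟨Finset.mem_univ j, ?_⟩
  rw [(Finset.mem_filter.1 hj).2]
  exact Nat.cast_le.2 n.le_succ

/-- Each pair across the boundary has a geodesic through some s in ∂X, so its exponential factors at
s. Summing freely over both ends costs one lattice sum each. -/
lemma sum_exp_boundary_pairs_le {D : ℕ} {γ ν : ℝ} (hγ : 1 ≤ γ) (hν : 0 < ν)
    (hL : IsLattice G D γ) (X : Finset Λ) :
    ∑ i ∈ X, ∑ j ∈ Xᶜ, exp (-ν * (G.dist i j : ℝ)) ≤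
      (surface G X).card * latticeSum D γ ν ^ 2 := by
  have hS := sum_exp_dist_le_latticeSum hγ hν hL
  calc ∑ i ∈ X, ∑ j ∈ Xᶜ, exp (-ν * (G.dist i j : ℝ))
      ≤ ∑ i ∈ X, ∑ j ∈ Xᶜ, ∑ s ∈ surface G X,
          exp (-ν * (G.dist s i : ℝ)) * exp (-ν * (G.dist s j : ℝ)) := by
        refine Finset.sum_le_sum fun i hi => Finset.sum_le_sum fun j hj => ?_
        obtain ⟨s, hs, h⟩ :=
          exists_mem_surface_dist_add_le hL.connected hi (Finset.mem_compl.1 hj)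
        refine le_trans ?_ (Finset.single_le_sum (f := fun s =>
          exp (-ν * (G.dist s i : ℝ)) * exp (-ν * (G.dist s j : ℝ)))
          (fun s _ => by positivity) hs)
        rw [← exp_add, exp_le_exp, G.dist_comm (u := s) (v := i)]
        have h' : (G.dist i s : ℝ) + G.dist s j ≤ G.dist i j := by exact_mod_cast h
        nlinarith
    _ ≤ ∑ i, ∑ j, ∑ s ∈ surface G X,
          exp (-ν * (G.dist s i : ℝ)) * exp (-ν * (G.dist s j : ℝ)) := by
        refine (Finset.sum_le_sum fun i _ => Finset.sum_le_sum_of_subset_of_nonneg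
          (Finset.subset_univ _) fun j _ _ => ?_).trans (Finset.sum_le_sum_of_subset_of_nonneg
          (Finset.subset_univ _) fun i _ _ => ?_) <;> positivity
    _ = ∑ s ∈ surface G X, (∑ i, exp (-ν * (G.dist s i : ℝ))) *
          ∑ j, exp (-ν * (G.dist s j : ℝ)) := by
        simp_rw [Finset.sum_mul_sum]
        rw [Finset.sum_comm (s := surface G X)]
        refine Finset.sum_congr rfl fun i _ => ?_
        rw [Finset.sum_comm]
    _ ≤ ∑ s ∈ surface G X, latticeSum D γ ν * latticeSum D γ ν := by
        refine Finset.sum_le_sum fun s _ => mul_le_mul (hS s) (hS s)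
          (Finset.sum_nonneg fun _ _ => (exp_pos _).le) (latticeSum_pos D hγ hν).le
    _ = _ := by rw [Finset.sum_const, nsmul_eq_mul, sq]

end GeometryLemmas

/-! ### The Lieb–Robinson bound for short-range interactions. -/

section LiebRobinsonBound

variable {Λ : Type u} [Fintype Λ] [DecidableEq Λ] {G : SimpleGraph Λ} {d₀ k D : ℕ}
  {h : Finset Λ → SpinOp Λ d₀} {γ g g₀ μ₀ : ℝ}

/-- Half of the decay μ₀ compensates the variation of a, and the other half is summed over the
lattice; the diagonal pair contributes the one-site energy g. -/
lemma sum_pairStrength_mul_le (hγ : 1 ≤ γ) (hμ₀ : 0 < μ₀) (hg₀ : 0 < g₀) (hL : IsLattice G D γ)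
    (hI : IsShortRange G h k g g₀ μ₀) {a : Λ → ℝ} (ha : ∀ i, 0 ≤ a i)
    (hexp : ∀ l m, a m ≤ exp (μ₀ / 2 * (G.dist l m : ℝ)) * a l) (l : Λ) :
    ∑ m, pairStrength h l m * a m ≤ (g + g₀ * latticeSum D γ (μ₀ / 2)) * a l := by
  have h1 : ∀ m, pairStrength h l m * a m ≤
      (if m = l then g * a l else 0) + g₀ * exp (-(μ₀ / 2) * (G.dist l m : ℝ)) * a l := by
    intro m
    by_cases hm : m = l
    · subst hm
      have : pairStrength h m m ≤ g := by
        simpa [pairStrength] using hI.one_site_le m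
      rw [if_pos rfl]
      have h2 := mul_le_mul_of_nonneg_right this (ha m)
      have h3 : 0 ≤ g₀ * exp (-(μ₀ / 2) * (G.dist m m : ℝ)) * a m :=
        mul_nonneg (by positivity) (ha m)
      linarith
    · rw [if_neg hm, zero_add]
      calc pairStrength h l m * a m
          ≤ (g₀ * exp (-μ₀ * (G.dist l m : ℝ))) * (exp (μ₀ / 2 * (G.dist l m : ℝ)) * a l) :=
            mul_le_mul (hI.two_site_le l m (Ne.symm hm)) (hexp l m) (ha m) (by positivity)
        _ = g₀ * exp (-(μ₀ / 2) * (G.dist l m : ℝ)) * a l := by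
            rw [← mul_assoc, mul_assoc g₀, ← exp_add]
            congr 3
            ring
  refine (Finset.sum_le_sum fun m _ => h1 m).trans ?_
  rw [Finset.sum_add_distrib, ← Finset.sum_mul, ← Finset.mul_sum, add_mul]
  refine add_le_add (by simp) ?_
  exact mul_le_mul_of_nonneg_right (mul_le_mul_of_nonneg_left
    (sum_exp_dist_le_latticeSum hγ (by positivity) hL l) hg₀.le) (ha l)

lemma norm_commutator_le_card_surface (hγ : 1 ≤ γ) (hg : 0 < g) (hg₀ : 0 < g₀) (hμ₀ : 0 < μ₀)
    (hL : IsLattice G D γ) (hI : IsShortRange G h k g g₀ μ₀) {X Y : Finset Λ}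
    (hY : Y.Nonempty) (hXY : 0 < siteDist G X Y) {OX OY : SpinOp Λ d₀}
    (hOX : SupportedOn X OX) (hOY : SupportedOn Y OY) (hX1 : ‖OX‖ = 1) (hY1 : ‖OY‖ = 1)
    {t : ℝ} (ht : 0 ≤ t) :
    ‖timeEvolution (hamiltonian h) OX t * OY - OY * timeEvolution (hamiltonian h) OX t‖ ≤
      4 * g₀ * latticeSum D γ (μ₀ / 2) ^ 2 / (g + g₀ * latticeSum D γ (μ₀ / 2)) *
        (surface G X).card * (exp (2 * (g + g₀ * latticeSum D γ (μ₀ / 2)) * t) - 1) *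
        exp (-(μ₀ / 2) * (siteDist G X Y : ℝ)) := by
  have hμ : 0 < μ₀ / 2 := by positivity
  set S := latticeSum D γ (μ₀ / 2)
  have hS : 0 < S := latticeSum_pos D hγ hμ
  set K := g + g₀ * S
  have hK : 0 < K := by positivity
  have hG := hL.connected
  set R := siteDist G X Y
  let a : Λ → ℝ := fun l => exp (-(μ₀ / 2) * (siteDist G {l} Y : ℝ))
  have ha : ∀ i, 0 ≤ a i := fun i => (exp_pos _).le
  have haY : ∀ i ∈ Y, 1 ≤ a i := fun i hi => by
    have : siteDist G {i} Y = 0 := by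
      simpa using siteDist_le_dist (G := G) (Finset.mem_singleton_self i) hi
    simp [a, this]
  have hexp : ∀ l m, a m ≤ exp (μ₀ / 2 * (G.dist l m : ℝ)) * a l := fun l m => by
    have h1 : (siteDist G {l} Y : ℝ) ≤ G.dist l m + siteDist G {m} Y := by
      exact_mod_cast siteDist_le_dist_add hG hY (Finset.mem_singleton_self l) m
    simp only [a]
    rw [← exp_add, exp_le_exp]
    nlinarith
  have hKa := sum_pairStrength_mul_le hγ hμ₀ hg₀ hL hI ha hexp
  have hK1 : ∀ l, ∑ m, pairStrength h l m ≤ K := fun l => by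
    simpa using sum_pairStrength_mul_le hγ hμ₀ hg₀ hL hI (a := fun _ => 1)
      (fun _ => zero_le_one) (fun l m => by simpa using by positivity) l
  have key := norm_commutator_le_boundary_pairs hI.hermitian hI.supported ha haY hK hKa hK1 hOY hY1
    hOX (disjoint_of_siteDist_pos hXY) ht
  rw [hX1, mul_one] at key
  refine key.trans ?_
  have hE : 0 ≤ exp (2 * K * t) - 1 := by
    have : 0 ≤ 2 * K * t := by positivity
    linarith [one_le_exp this]
  -- Inside X the weight is at most exp(-(μ₀/2)R). Outside it may be larger by exp((μ₀/2) d(i,j)),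
  -- which half of the interaction decay pays for.
  have hP : ∑ i ∈ X, ∑ j ∈ Xᶜ, pairStrength h i j * (a i + a j) ≤
      2 * g₀ * exp (-(μ₀ / 2) * R) * ((surface G X).card * S ^ 2) := by
    refine le_trans ?_ (mul_le_mul_of_nonneg_left (sum_exp_boundary_pairs_le hγ hμ hL X)
      (by positivity))
    simp_rw [Finset.mul_sum]
    refine Finset.sum_le_sum fun i hi => Finset.sum_le_sum fun j hj => ?_
    have hij : i ≠ j := fun e => Finset.mem_compl.1 hj (e ▸ hi)
    have hai : a i ≤ exp (-(μ₀ / 2) * R) := by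
      have h1 : (R : ℝ) ≤ siteDist G {i} Y := by
        have := siteDist_le_dist_add hG hY hi i
        rw [SimpleGraph.dist_self, zero_add] at this
        exact_mod_cast this
      simp only [a]
      rw [exp_le_exp]
      nlinarith
    have hai' : a i ≤ exp (-(μ₀ / 2) * R) * exp (μ₀ / 2 * (G.dist i j : ℝ)) :=
      hai.trans (le_mul_of_one_le_right (exp_pos _).le (one_le_exp (by positivity)))
    have haj : a j ≤ exp (-(μ₀ / 2) * R) * exp (μ₀ / 2 * (G.dist i j : ℝ)) := by
      refine (hexp i j).trans ?_
      rw [mul_comm]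
      exact mul_le_mul_of_nonneg_right hai (exp_pos _).le
    calc pairStrength h i j * (a i + a j)
        ≤ (g₀ * exp (-μ₀ * (G.dist i j : ℝ))) *
          (2 * (exp (-(μ₀ / 2) * R) * exp (μ₀ / 2 * (G.dist i j : ℝ)))) :=
          mul_le_mul (hI.two_site_le i j hij) (by linarith) (add_nonneg (ha i) (ha j))
            (by positivity)
      _ = 2 * g₀ * exp (-(μ₀ / 2) * R) *
          (exp (-μ₀ * (G.dist i j : ℝ)) * exp (μ₀ / 2 * (G.dist i j : ℝ))) := by ring
      _ = _ := by
          rw [← exp_add]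
          congr 2
          ring
  refine (mul_le_mul_of_nonneg_left hP (by positivity)).trans (le_of_eq ?_)
  field_simp
  ring

/-- Conjugation by the propagator moves the evolution to the other operator; this lets the surface
of Y replace that of X. -/
lemma norm_commutator_timeEvolution_neg {H : SpinOp Λ d₀} (hH : H.IsHermitian)
    (O O' : SpinOp Λ d₀) (t : ℝ) :
    ‖timeEvolution H O t * O' - O' * timeEvolution H O t‖ =
      ‖timeEvolution H O' (-t) * O - O * timeEvolution H O' (-t)‖ := by
  have e : timeEvolution H O t * O' - O' * timeEvolution H O t =
      propagator H t * (O * timeEvolution H O' (-t) - timeEvolution H O' (-t) * O) *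
        propagator H (-t) := by
    have h1 : propagator H t * (O * timeEvolution H O' (-t)) * propagator H (-t) =
        propagator H t * O * propagator H (-t) * O' * (propagator H t * propagator H (-t)) := by
      simp only [timeEvolution_eq, mul_assoc, neg_neg]
    have h2 : propagator H t * (timeEvolution H O' (-t) * O) * propagator H (-t) =
        (propagator H t * propagator H (-t)) * O' * (propagator H t * O * propagator H (-t)) := by
      simp only [timeEvolution_eq, mul_assoc, neg_neg]
    rw [mul_sub, sub_mul, h1, h2, propagator_mul_neg, mul_one, one_mul, timeEvolution_eq]
  rw [e, CStarRing.norm_mul_mem_unitary _ (propagator_mem_unitary hH _),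
    CStarRing.norm_mem_unitary_mul _ (propagator_mem_unitary hH _), norm_sub_rev]

lemma timeEvolution_neg (H O : SpinOp Λ d₀) (t : ℝ) :
    timeEvolution H O (-t) = timeEvolution (-H) O t := by
  simp [timeEvolution]

/-- Reversing time amounts to changing the sign of the interaction, so negative times follow from
positive ones. -/
lemma IsShortRange.neg (hI : IsShortRange G h k g g₀ μ₀) :
    IsShortRange G (fun Z => -h Z) k g g₀ μ₀ where
  hermitian Z := (hI.hermitian Z).neg
  supported Z := by simpa using (hI.supported Z).smul (-1)
  few_body Z hZ := by simp [hI.few_body Z hZ]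
  one_site_le i := by simpa using hI.one_site_le i
  two_site_le i j hij := by simpa using hI.two_site_le i j hij

/-- The Lieb–Robinson bound for short-range interactions. -/
theorem liebRobinsonBound_of_isShortRange (hγ : 1 ≤ γ) (hg : 0 < g) (hg₀ : 0 < g₀)
    (hμ₀ : 0 < μ₀) (hL : IsLattice G D γ) (hI : IsShortRange G h k g g₀ μ₀) :
    LiebRobinsonBound G (hamiltonian h)
      (4 * g₀ * latticeSum D γ (μ₀ / 2) ^ 2 / (g + g₀ * latticeSum D γ (μ₀ / 2)))
      (2 * (g + g₀ * latticeSum D γ (μ₀ / 2))) (μ₀ / 2) := by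
  have one_sided : ∀ X Y : Finset Λ, Y.Nonempty → 0 < siteDist G X Y →
      ∀ OX OY : SpinOp Λ d₀, SupportedOn X OX → SupportedOn Y OY → ‖OX‖ = 1 → ‖OY‖ = 1 →
      ∀ t : ℝ,
        ‖timeEvolution (hamiltonian h) OX t * OY - OY * timeEvolution (hamiltonian h) OX t‖ ≤
          4 * g₀ * latticeSum D γ (μ₀ / 2) ^ 2 / (g + g₀ * latticeSum D γ (μ₀ / 2)) *
            (surface G X).card * (exp (2 * (g + g₀ * latticeSum D γ (μ₀ / 2)) * |t|) - 1) *
            exp (-(μ₀ / 2) * (siteDist G X Y : ℝ)) := by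
    intro X Y hY hXY OX OY hOX hOY h1 h2 t
    rcases le_total 0 t with ht | ht
    · rw [abs_of_nonneg ht]
      exact norm_commutator_le_card_surface hγ hg hg₀ hμ₀ hL hI hY hXY hOX hOY h1 h2 ht
    · have key := norm_commutator_le_card_surface hγ hg hg₀ hμ₀ hL hI.neg hY hXY hOX hOY h1 h2
        (neg_nonneg.2 ht)
      have e : hamiltonian (fun Z => -h Z) = -hamiltonian h := by simp [hamiltonian]
      rw [e, ← timeEvolution_neg, neg_neg] at key
      rwa [abs_of_nonpos ht]
  intro X Y hX hY hXY OX OY hOX hOY h1 h2 t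
  rcases min_choice (surface G X).card (surface G Y).card with hm | hm
  · rw [hm]
    exact one_sided X Y hY hXY OX OY hOX hOY h1 h2 t
  · rw [hm, norm_commutator_timeEvolution_neg (H := hamiltonian h)
      (isHermitian_sum _ hI.hermitian), siteDist_comm X Y,
      ← abs_neg]
    exact one_sided Y X hX (siteDist_comm X Y ▸ hXY) OY OX hOY hOX h2 h1 (-t)

end LiebRobinsonBound

/-! ### Entrywise bounds and diagonalization of matrices. -/

section MatrixEntries

variable {n : Type*} [Fintype n] [DecidableEq n]

lemma sum_sq_norm_column_le (A : Matrix n n ℂ) (j : n) : ∑ i, ‖A i j‖ ^ 2 ≤ ‖A‖ ^ 2 := by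
  have h := A.l2_opNorm_mulVec (EuclideanSpace.single j 1)
  rw [PiLp.norm_single, norm_one, mul_one] at h
  have h2 := pow_le_pow_left₀ (norm_nonneg _) h 2
  rw [EuclideanSpace.norm_sq_eq] at h2
  simpa using h2

lemma sum_sq_norm_row_le (A : Matrix n n ℂ) (i : n) : ∑ j, ‖A i j‖ ^ 2 ≤ ‖A‖ ^ 2 := by
  have h := sum_sq_norm_column_le (Matrix.conjTranspose A) i
  rw [Matrix.l2_opNorm_conjTranspose] at h
  simpa using h

lemma norm_entry_le_l2_opNorm (A : Matrix n n ℂ) (i j : n) : ‖A i j‖ ≤ ‖A‖ := by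
  refine le_of_sq_le_sq ?_ (norm_nonneg A)
  exact (Finset.single_le_sum (f := fun j => ‖A i j‖ ^ 2) (fun j _ => by positivity)
    (Finset.mem_univ j)).trans (sum_sq_norm_row_le A i)

lemma norm_trace_diagonal_mul_le {p : n → ℝ} (hp : ∀ j, 0 ≤ p j) (hp1 : ∑ j, p j = 1)
    (X : Matrix n n ℂ) : ‖(Matrix.diagonal (fun j => (p j : ℂ)) * X).trace‖ ≤ ‖X‖ := by
  simp only [Matrix.trace, Matrix.diag, Matrix.diagonal_mul]
  refine (norm_sum_le _ _).trans ?_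
  calc ∑ j, ‖(p j : ℂ) * X j j‖ ≤ ∑ j, p j * ‖X‖ := Finset.sum_le_sum fun j _ => by
        rw [norm_mul, Complex.norm_real, Real.norm_of_nonneg (hp j)]
        exact mul_le_mul_of_nonneg_left (norm_entry_le_l2_opNorm X j j) (hp j)
    _ = ‖X‖ := by rw [← Finset.sum_mul, hp1, one_mul]

lemma trace_diagonal_mul_mul_diagonal_mul (d e : n → ℂ) (A B : Matrix n n ℂ) :
    (Matrix.diagonal d * A * Matrix.diagonal e * B).trace =
      ∑ j, ∑ k, d j * e k * (A j k * B k j) := by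
  simp only [Matrix.trace, Matrix.diag]
  refine Finset.sum_congr rfl fun j _ => ?_
  rw [Matrix.mul_apply]
  refine Finset.sum_congr rfl fun k _ => ?_
  rw [Matrix.mul_diagonal, Matrix.diagonal_mul]
  ring

/-- Hölder's inequality for `tr (ρ^(1-α) A ρ^α B)` in an eigenbasis of the state `ρ`. -/
lemma norm_sum_rpow_mul_le {p : n → ℝ} (hp : ∀ j, 0 ≤ p j) (hp1 : ∑ j, p j = 1)
    {A B : Matrix n n ℂ} (hA : ‖A‖ ≤ 1) (hB : ‖B‖ ≤ 1) {α : ℝ} (h0 : 0 ≤ α) (h1 : α ≤ 1) :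
    ‖∑ j, ∑ k, ((p j ^ (1 - α) : ℝ) : ℂ) * ((p k ^ α : ℝ) : ℂ) * (A j k * B k j)‖ ≤ 1 := by
  have hA2 : ‖A‖ ^ 2 ≤ 1 := pow_le_one₀ (norm_nonneg _) hA
  have hB2 : ‖B‖ ^ 2 ≤ 1 := pow_le_one₀ (norm_nonneg _) hB
  -- `q` dominates |A_jk B_kj| and is doubly substochastic, while weighted AM–GM bounds p_j^(1-α)
  -- p_k^α by (1-α) p_j + α p_k.
  let q : n → n → ℝ := fun j k => (‖A j k‖ ^ 2 + ‖B k j‖ ^ 2) / 2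
  have hq : ∀ j k, 0 ≤ q j k := fun j k => by positivity
  have hrow : ∀ j, ∑ k, q j k ≤ 1 := fun j => by
    simp only [q]
    rw [← Finset.sum_div, Finset.sum_add_distrib]
    linarith [sum_sq_norm_row_le A j, sum_sq_norm_column_le B j]
  have hcol : ∀ k, ∑ j, q j k ≤ 1 := fun k => by
    simp only [q]
    rw [← Finset.sum_div, Finset.sum_add_distrib]
    linarith [sum_sq_norm_column_le A k, sum_sq_norm_row_le B k]
  calc ‖∑ j, ∑ k, ((p j ^ (1 - α) : ℝ) : ℂ) * ((p k ^ α : ℝ) : ℂ) * (A j k * B k j)‖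
      ≤ ∑ j, ∑ k, ((1 - α) * (p j * q j k) + α * (p k * q j k)) := by
        refine (norm_sum_le _ _).trans (Finset.sum_le_sum fun j _ => (norm_sum_le _ _).trans
          (Finset.sum_le_sum fun k _ => ?_))
        have e1 : 0 ≤ p j ^ (1 - α) := rpow_nonneg (hp j) _
        have e2 : 0 ≤ p k ^ α := rpow_nonneg (hp k) _
        rw [norm_mul, norm_mul, norm_mul, Complex.norm_real, Complex.norm_real,
          Real.norm_of_nonneg e1, Real.norm_of_nonneg e2]
        have h3 := Real.geom_mean_le_arith_mean2_weighted (sub_nonneg.2 h1) h0 (hp j) (hp k)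
          (by ring)
        have h4 : ‖A j k‖ * ‖B k j‖ ≤ q j k := by
          simp only [q]
          linarith [two_mul_le_add_sq ‖A j k‖ ‖B k j‖]
        calc _ ≤ ((1 - α) * p j + α * p k) * q j k :=
              mul_le_mul h3 h4 (by positivity) ((mul_nonneg e1 e2).trans h3)
          _ = _ := by ring
    _ = (1 - α) * ∑ j, p j * ∑ k, q j k + α * ∑ k, p k * ∑ j, q j k := by
        simp_rw [Finset.sum_add_distrib, Finset.mul_sum]
        congr 1
        exact Finset.sum_comm
    _ ≤ (1 - α) * ∑ j, p j + α * ∑ k, p k :=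
        add_le_add
          (mul_le_mul_of_nonneg_left (Finset.sum_le_sum fun j _ =>
            mul_le_of_le_one_right (hp j) (hrow j)) (sub_nonneg.2 h1))
          (mul_le_mul_of_nonneg_left (Finset.sum_le_sum fun k _ =>
            mul_le_of_le_one_right (hp k) (hcol k)) h0)
    _ = 1 := by rw [hp1]; ring

/-- A Hermitian matrix is diagonalized by a trace- and norm-preserving automorphism that is
compatible with exponentials and with the functional calculus. -/
lemma exists_diagonalization {H : Matrix n n ℂ} (hH : H.IsHermitian) :
    ∃ (φ : Matrix n n ℂ ≃⋆ₐ[ℂ] Matrix n n ℂ) (E : n → ℝ),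
      (∀ X, (φ X).trace = X.trace) ∧ (∀ X, ‖φ X‖ = ‖X‖) ∧
      (∀ c : ℂ, NormedSpace.exp (c • H) =
        φ (Matrix.diagonal fun j => Complex.exp (c * E j))) ∧
      ∀ f : ℝ → ℝ, cfc f H = φ (Matrix.diagonal fun j => (f (E j) : ℂ)) := by
  set U : Matrix n n ℂ := hH.eigenvectorUnitary.1
  have hUmem : U ∈ unitary (Matrix n n ℂ) := hH.eigenvectorUnitary.2
  obtain ⟨φ, hφ, hφcfc⟩ : ∃ φ : Matrix n n ℂ ≃⋆ₐ[ℂ] Matrix n n ℂ, (∀ X, φ X = U * X * star U) ∧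
      ∀ f : ℝ → ℝ, cfc f H = φ (Matrix.diagonal fun j => (f (hH.eigenvalues j) : ℂ)) :=
    ⟨Unitary.conjStarAlgAut ℂ (Matrix n n ℂ) hH.eigenvectorUnitary,
      fun X => Unitary.conjStarAlgAut_apply _ _, fun f => by rw [hH.cfc_eq]; rfl⟩
  have hid : H = φ (Matrix.diagonal fun j => (hH.eigenvalues j : ℂ)) := by
    exact (cfc_id' ℝ H hH).symm.trans (hφcfc fun x => x)
  refine ⟨φ, hH.eigenvalues, fun X => ?_, fun X => ?_, fun c => ?_, hφcfc⟩
  · rw [hφ, Matrix.trace_mul_cycle, Unitary.star_mul_self_of_mem hUmem, one_mul]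
  · rw [hφ, CStarRing.norm_mul_mem_unitary _ (Unitary.star_mem hUmem),
      CStarRing.norm_mem_unitary_mul _ hUmem]
  · let _ : NormedAlgebra ℚ (Matrix n n ℂ) := NormedAlgebra.restrictScalars ℚ ℂ _
    have e : c • H = φ (Matrix.diagonal fun j => c * hH.eigenvalues j) := by
      have : (Matrix.diagonal fun j => c * (hH.eigenvalues j : ℂ)) =
          c • Matrix.diagonal fun j => (hH.eigenvalues j : ℂ) := by
        rw [← Matrix.diagonal_smul]
        rfl
      rw [this, map_smul, ← hid]
    have hcont : Continuous φ := by
      have hc : Continuous fun X : Matrix n n ℂ => U * X * star U :=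
        (continuous_const.mul continuous_id).mul continuous_const
      exact hc.congr fun X => (hφ X).symm
    rw [e, ← NormedSpace.map_exp φ hcont, Matrix.exp_diagonal]
    congr 2
    funext j
    rw [Pi.coe_exp, Complex.exp_eq_exp_ℂ]

end MatrixEntries

/-! ### Gibbs states and correlations in an energy eigenbasis. -/

section Spectral

variable {Λ : Type u} [Fintype Λ] [DecidableEq Λ] {d₀ : ℕ}

/-- The Gibbs weights of the energies `E`. -/
noncomputable def gibbsWeight {n : Type*} [Fintype n] (E : n → ℝ) (β : ℝ) (j : n) : ℝ :=
  exp (-β * E j) / ∑ k, exp (-β * E k)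

lemma gibbsWeight_pos {n : Type*} [Fintype n] (E : n → ℝ) (β : ℝ) (j : n) :
    0 < gibbsWeight E β j :=
  div_pos (exp_pos _) (Finset.sum_pos (fun _ _ => exp_pos _) ⟨j, Finset.mem_univ j⟩)

lemma sum_gibbsWeight {n : Type*} [Fintype n] [Nonempty n] (E : n → ℝ) (β : ℝ) :
    ∑ j, gibbsWeight E β j = 1 := by
  unfold gibbsWeight
  rw [← Finset.sum_div]
  exact div_self (Finset.sum_pos (fun _ _ => exp_pos _) Finset.univ_nonempty).ne'

lemma gibbsWeight_eq_mul {n : Type*} [Fintype n] (E : n → ℝ) (β : ℝ) (j k : n) :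
    gibbsWeight E β k = gibbsWeight E β j * exp (β * (E j - E k)) := by
  unfold gibbsWeight
  rw [div_mul_eq_mul_div, ← exp_add]
  congr 2
  ring

lemma gibbsWeight_rpow_mul_rpow {n : Type*} [Fintype n] (E : n → ℝ) (β α : ℝ) (j k : n) :
    gibbsWeight E β j ^ (1 - α) * gibbsWeight E β k ^ α =
      gibbsWeight E β j * exp (α * (β * (E j - E k))) := by
  have hj := gibbsWeight_pos E β j
  rw [gibbsWeight_eq_mul E β j k, mul_rpow hj.le (exp_pos _).le, ← mul_assoc, ← rpow_add hj,
    sub_add_cancel, rpow_one, ← exp_mul]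
  congr 2
  ring

/-- The correlation and the commutator correlation function in an energy eigenbasis. -/
lemma exists_eigenbasis_representation {H : SpinOp Λ d₀} (hH : H.IsHermitian) (β : ℝ)
    (OA OB : SpinOp Λ d₀) :
    ∃ (E : (Λ → Fin d₀) → ℝ) (A B : SpinOp Λ d₀), ‖A‖ = ‖OA‖ ∧ ‖B‖ = ‖OB‖ ∧
      (∀ α, wydCorrelation (gibbsState H β) α OA OB =
        (Matrix.diagonal (fun j => (gibbsWeight E β j : ℂ)) * (A * B)).trace -
        ∑ j, ∑ k, ((gibbsWeight E β j ^ (1 - α) : ℝ) : ℂ) * ((gibbsWeight E β k ^ α : ℝ) : ℂ) *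
          (A j k * B k j)) ∧
      ∀ t, ∃ X : SpinOp Λ d₀,
        ‖X‖ = ‖timeEvolution H OA t * OB - OB * timeEvolution H OA t‖ ∧
        (Matrix.diagonal (fun j => (gibbsWeight E β j : ℂ)) * X).trace =
          ∑ j, ∑ k, ((gibbsWeight E β j - gibbsWeight E β k : ℝ) : ℂ) * (A j k * B k j) *
            Complex.exp (Complex.I * ((E j - E k : ℝ) : ℂ) * t) := by
  obtain ⟨φ, E, htr, hnorm, hexp, hcfc⟩ := exists_diagonalization hH
  have hA : φ (φ.symm OA) = OA := φ.apply_symm_apply OA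
  have hB : φ (φ.symm OB) = OB := φ.apply_symm_apply OB
  set A := φ.symm OA
  set B := φ.symm OB
  have hcast : (Matrix.diagonal fun j => Complex.exp (((-β : ℝ) : ℂ) * E j)) =
      Matrix.diagonal fun j => ((exp (-β * E j) : ℝ) : ℂ) := by
    congr 1
    funext j
    push_cast
    rfl
  have hρ : gibbsState H β = φ (Matrix.diagonal fun j => (gibbsWeight E β j : ℂ)) := by
    rw [gibbsState, hexp, htr, hcast, ← map_smul, ← Matrix.diagonal_smul, Matrix.trace_diagonal]
    congr 2
    funext j
    simp [gibbsWeight, div_eq_inv_mul]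
  have hρcfc : gibbsState H β = cfc (fun x => exp (-β * x) / ∑ k, exp (-β * E k)) H := by
    rw [hρ, hcfc]
    rfl
  -- The state is a positive function of H, so its real powers come from composing functional
  -- calculi. Positivity of the partition function needs a nonempty basis; over an empty one all
  -- matrices agree.
  have hρpow : ∀ s : ℝ, gibbsState H β ^ s =
      φ (Matrix.diagonal fun j => ((gibbsWeight E β j ^ s : ℝ) : ℂ)) := fun s => by
    rcases isEmpty_or_nonempty (Λ → Fin d₀) with hn | hn
    · exact Subsingleton.elim _ _
    · have hZ : 0 < ∑ k, exp (-β * E k) :=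
        Finset.sum_pos (fun _ _ => exp_pos _) Finset.univ_nonempty
      rw [hρcfc, CFC.cfc_rpow (fun x _ => div_pos (exp_pos _) hZ) (by fun_prop) hH, hcfc]
      rfl
  refine ⟨E, A, B, by rw [← hA, hnorm], by rw [← hB, hnorm], fun α => ?_, fun t => ?_⟩
  · rw [wydCorrelation, hρpow, hρpow, hρ, ← hA, ← hB]
    simp only [← map_mul, htr]
    rw [trace_diagonal_mul_mul_diagonal_mul, mul_assoc]
  · let e : ℝ → SpinOp Λ d₀ := fun t =>
      Matrix.diagonal fun j => Complex.exp (Complex.I * t * E j)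
    have hev : timeEvolution H OA t = φ (e t * A * e (-t)) := by
      rw [timeEvolution, hexp, hexp, map_mul, map_mul, hA]
      simp [e]
    refine ⟨e t * A * e (-t) * B - B * (e t * A * e (-t)), ?_, ?_⟩
    · rw [hev, ← hnorm, map_sub, map_mul φ _ B, map_mul φ B, hB]
    · have h1 : (Matrix.diagonal (fun j => (gibbsWeight E β j : ℂ)) *
          (e t * A * e (-t) * B)).trace = ∑ j, ∑ k, gibbsWeight E β j *
            Complex.exp (Complex.I * t * E j) * Complex.exp (Complex.I * (-t : ℝ) * E k) *
              (A j k * B k j) := by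
        rw [← mul_assoc, ← mul_assoc, ← mul_assoc, Matrix.diagonal_mul_diagonal,
          trace_diagonal_mul_mul_diagonal_mul]
      have h2 : (Matrix.diagonal (fun j => (gibbsWeight E β j : ℂ)) *
          (B * (e t * A * e (-t)))).trace = ∑ j, ∑ k, Complex.exp (Complex.I * t * E j) *
            (Complex.exp (Complex.I * (-t : ℝ) * E k) * gibbsWeight E β k) *
              (A j k * B k j) := by
        rw [← mul_assoc, Matrix.trace_mul_comm, ← mul_assoc, mul_assoc (e t * A),
          Matrix.diagonal_mul_diagonal, trace_diagonal_mul_mul_diagonal_mul]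
      rw [mul_sub, Matrix.trace_sub, h1, h2, ← Finset.sum_sub_distrib]
      refine Finset.sum_congr rfl fun j _ => ?_
      rw [← Finset.sum_sub_distrib]
      refine Finset.sum_congr rfl fun k _ => ?_
      have h3 : Complex.exp (Complex.I * ((E j - E k : ℝ) : ℂ) * t) =
          Complex.exp (Complex.I * t * E j) * Complex.exp (Complex.I * (-t : ℝ) * E k) := by
        rw [← Complex.exp_add]
        congr 1
        push_cast
        ring
      rw [h3]
      push_cast
      ring

end Spectral

/-! ### Fourier series of the thermal filter in α. -/

section FourierSeries

lemma two_pi_I_mul_ne_zero {n : ℤ} (hn : n ≠ 0) : 2 * π * Complex.I * n ≠ 0 := by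
  simp [Real.pi_ne_zero, hn]

lemma sub_two_pi_I_mul_ne_zero {x : ℝ} (hx : x ≠ 0) (n : ℤ) :
    (x : ℂ) - 2 * π * Complex.I * n ≠ 0 := by
  intro h
  have := congrArg Complex.re h
  simp at this
  exact hx this

lemma exp_sub_two_pi_I_mul (x : ℝ) (n : ℤ) :
    Complex.exp (x - 2 * π * Complex.I * n) = Complex.exp x := by
  rw [show 2 * π * Complex.I * n = n * (2 * π * Complex.I) by ring,
    Complex.exp_sub, Complex.exp_int_mul_two_pi_mul_I, div_one]

lemma complex_exp_sub_one_ne_zero {x : ℝ} (hx : x ≠ 0) : Complex.exp x - 1 ≠ 0 := by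
  rw [sub_ne_zero, ← Complex.ofReal_exp]
  exact_mod_cast fun h => hx (Real.exp_eq_one_iff x |>.1 h)

/-- The Fourier coefficients of `a ↦ (exp (ax) - 1) / (exp x - 1) - a` on `[0, 1]`. -/
lemma fourierCoeffOn_exp_sub_id {x : ℝ} (hx : x ≠ 0) {n : ℤ} (hn : n ≠ 0) :
    fourierCoeffOn zero_lt_one
      (fun a : ℝ => (Complex.exp (x * a) - 1) / (Complex.exp x - 1) - a) n =
      x / (2 * π * Complex.I * n * (x - 2 * π * Complex.I * n)) := by
  have hE := complex_exp_sub_one_ne_zero hx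
  have hd : ∀ a : ℝ, HasDerivAt
      (fun a : ℝ => (Complex.exp (x * a) - 1) / (Complex.exp x - 1) - a)
      (x * Complex.exp (x * a) / (Complex.exp x - 1) - 1) a := fun a => by
    have h1 : HasDerivAt (fun a : ℝ => (x : ℂ) * (a : ℂ)) x a := by
      simpa using (Complex.ofRealCLM.hasDerivAt (x := a)).const_mul (x : ℂ)
    have h2 := ((h1.cexp.sub_const 1).div_const (Complex.exp x - 1)).sub
      (Complex.ofRealCLM.hasDerivAt (x := a))
    refine h2.congr_deriv ?_
    simp [mul_comm]
  -- Integration by parts: the function vanishes at both endpoints, so only the coefficient of its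
  -- derivative, x/(x - 2πin), remains.
  rw [fourierCoeffOn_of_hasDerivAt zero_lt_one hn (fun a _ => hd a)
    (Continuous.intervalIntegrable (by fun_prop) _ _), fourierCoeffOn_eq_integral]
  have hint : ∫ a in (0 : ℝ)..1, (fourier (-n) (a : AddCircle ((1 : ℝ) - 0))) •
      ((x : ℂ) * Complex.exp (x * a) / (Complex.exp x - 1) - 1) =
      x / (x - 2 * π * Complex.I * n) := by
    have e : ∀ a : ℝ, (fourier (-n) (a : AddCircle ((1 : ℝ) - 0))) •
        ((x : ℂ) * Complex.exp (x * a) / (Complex.exp x - 1) - 1) =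
        x / (Complex.exp x - 1) * Complex.exp ((x - 2 * π * Complex.I * n) * a) -
          Complex.exp ((-(2 * π * Complex.I * n)) * a) := fun a => by
      rw [fourier_coe_apply]
      have : Complex.exp ((x - 2 * π * Complex.I * n) * a) =
          Complex.exp (x * a) * Complex.exp ((-(2 * π * Complex.I * n)) * a) := by
        rw [← Complex.exp_add]
        congr 1
        ring
      rw [this]
      have h3 : 2 * π * Complex.I * ((-n : ℤ) : ℂ) * a / ((1 - 0 : ℝ) : ℂ) =
          (-(2 * π * Complex.I * n)) * a := by
        push_cast
        ring
      rw [h3, smul_eq_mul]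
      ring
    simp_rw [e]
    rw [intervalIntegral.integral_sub (Continuous.intervalIntegrable (by fun_prop) _ _)
      (Continuous.intervalIntegrable (by fun_prop) _ _), intervalIntegral.integral_const_mul,
      integral_exp_mul_complex (sub_two_pi_I_mul_ne_zero hx n),
      integral_exp_mul_complex (neg_ne_zero.2 (two_pi_I_mul_ne_zero hn))]
    have h4 : Complex.exp (-(2 * π * Complex.I * n)) = 1 := by
      simpa using exp_sub_two_pi_I_mul 0 n
    simp only [Complex.ofReal_one, mul_one, Complex.ofReal_zero, mul_zero, Complex.exp_zero,
      exp_sub_two_pi_I_mul, h4, sub_self, zero_div, sub_zero]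
    field_simp
  rw [hint]
  have h2 := two_pi_I_mul_ne_zero hn
  have h3 := sub_two_pi_I_mul_ne_zero hx n
  simp only [Complex.ofReal_zero, mul_zero, Complex.exp_zero, sub_self, zero_div,
    Complex.ofReal_one, mul_one, div_self hE, sub_zero, one_div, inv_one, one_smul, zero_sub,
    one_mul]
  rw [show -2 * (π : ℂ) * Complex.I * n = -(2 * π * Complex.I * n) by ring, inv_neg, neg_mul_neg,
    ← div_eq_inv_mul, div_div, mul_comm (_ - _)]

/-- Subtracting the Fourier series at 0, where the function vanishes, removes the constant mode. The
term n = 0 is therefore correctly 0, also through division by zero in its coefficient. -/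
lemma hasSum_exp_sub_id {x : ℝ} (hx : x ≠ 0) {α : ℝ} (h0 : 0 ≤ α) (h1 : α ≤ 1) :
    HasSum (fun n : ℤ => x / (2 * π * Complex.I * n * (x - 2 * π * Complex.I * n)) *
        (Complex.exp (2 * π * Complex.I * n * α) - 1))
      ((Complex.exp (x * α) - 1) / (Complex.exp x - 1) - α) := by
  have hE := complex_exp_sub_one_ne_zero hx
  rcases h1.eq_or_lt with rfl | h1
  · have e : ∀ n : ℤ, Complex.exp (2 * π * Complex.I * n) = 1 := fun n => by
      rw [show 2 * π * Complex.I * n = n * (2 * π * Complex.I) by ring,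
        Complex.exp_int_mul_two_pi_mul_I]
    simp only [Complex.ofReal_one, mul_one, e, sub_self, mul_zero, div_self hE]
    exact hasSum_zero
  · let g : ℝ → ℂ := fun a => (Complex.exp (x * a) - 1) / (Complex.exp x - 1) - a
    have hg0 : g 0 = 0 := by simp [g]
    have hg1 : g 1 = 0 := by simp [g, div_self hE]
    let f : C(UnitAddCircle, ℂ) := ⟨AddCircle.liftIco 1 0 g,
      AddCircle.liftIco_continuous (by rw [zero_add, hg0, hg1])
        (by fun_prop : Continuous g).continuousOn⟩
    have hcoeff : ∀ n : ℤ, n ≠ 0 → fourierCoeff f n =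
        x / (2 * π * Complex.I * n * (x - 2 * π * Complex.I * n)) := fun n hn => by
      have := fourierCoeff_liftIco_eq (T := 1) (a := 0) g n
      have h2 := fourierCoeffOn_exp_sub_id hx hn
      simp only [zero_add] at this
      exact this.trans h2
    have hsum : Summable (fourierCoeff f) := by
      refine Summable.of_norm_bounded_eventually
        (g := fun n : ℤ => |x| / (4 * π ^ 2) * (1 / (n : ℝ) ^ 2))
        ((Real.summable_one_div_int_pow.2 one_lt_two).mul_left _) ?_
      have hfin : {n : ℤ | n ≠ 0} ∈ Filter.cofinite := by
        rw [Filter.mem_cofinite]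
        exact (Set.finite_singleton 0).subset fun n hn => by simpa using hn
      filter_upwards [hfin] with n hn
      have hn : n ≠ 0 := hn
      have hn' : 0 < |(n : ℝ)| := abs_pos.2 (by exact_mod_cast hn)
      rw [hcoeff n hn, norm_div, norm_mul]
      have e1 : ‖2 * π * Complex.I * n‖ = 2 * π * |(n : ℝ)| := by
        simp [abs_of_pos Real.pi_pos]
      have e2 : 2 * π * |(n : ℝ)| ≤ ‖(x : ℂ) - 2 * π * Complex.I * n‖ := by
        refine le_trans (le_of_eq ?_) (Complex.abs_im_le_norm _)
        simp [abs_mul, abs_of_pos Real.pi_pos]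
      rw [e1, Complex.norm_real, Real.norm_eq_abs]
      calc |x| / (2 * π * |(n : ℝ)| * ‖(x : ℂ) - 2 * π * Complex.I * n‖)
          ≤ |x| / (2 * π * |(n : ℝ)| * (2 * π * |(n : ℝ)|)) := by gcongr
        _ = |x| / (4 * π ^ 2) * (1 / (n : ℝ) ^ 2) := by
          rw [← sq_abs (n : ℝ)]
          field_simp
          norm_num
    have hα := has_pointwise_sum_fourier_series_of_summable hsum ((α : ℝ) : UnitAddCircle)
    have h00 := has_pointwise_sum_fourier_series_of_summable hsum ((0 : ℝ) : UnitAddCircle)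
    -- The unknown zeroth coefficient cancels in this difference.
    have key := hα.sub h00
    have v1 : f ((α : ℝ) : UnitAddCircle) = g α :=
      AddCircle.liftIco_coe_apply (p := (1 : ℝ)) (a := 0) (f := g) ⟨h0, by linarith⟩
    have v2 : f ((0 : ℝ) : UnitAddCircle) = g 0 :=
      AddCircle.liftIco_coe_apply (p := (1 : ℝ)) (a := 0) (f := g) ⟨le_rfl, by linarith⟩
    rw [v1, v2, hg0, sub_zero] at key
    refine key.congr_fun ?_
    intro n
    rw [fourier_coe_apply, fourier_coe_apply]
    rcases eq_or_ne n 0 with rfl | hn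
    · simp
    · rw [hcoeff n hn]
      simp [mul_sub]

end FourierSeries

/-! ### Laplace transforms of trigonometric sums and the thermal filter. -/

section TrigonometricSums

open MeasureTheory Set

variable {ι : Type*} [Fintype ι] (w : ι → ℂ) (ω : ι → ℝ)

/-- The trigonometric sum `∑ i, w i exp (i ω_i t)`. -/
noncomputable def trigSum (t : ℝ) : ℂ := ∑ i, w i * Complex.exp (Complex.I * ω i * t)

lemma trigSum_neg (t : ℝ) : trigSum w (-ω) t = trigSum w ω (-t) := by
  simp [trigSum]

lemma exp_neg_mul_trigSum (a t : ℝ) :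
    (exp (-a * t) : ℂ) * trigSum w ω t =
      ∑ i, w i * Complex.exp ((-a + Complex.I * ω i) * t) := by
  rw [trigSum, Finset.mul_sum]
  refine Finset.sum_congr rfl fun i _ => ?_
  rw [add_mul, Complex.exp_add]
  push_cast
  ring

variable {a : ℝ}

lemma integrableOn_exp_neg_mul_trigSum (ha : 0 < a) :
    IntegrableOn (fun t : ℝ => (exp (-a * t) : ℂ) * trigSum w ω t) (Ioi 0) := by
  simp_rw [exp_neg_mul_trigSum]
  exact integrable_finsetSum _ fun i _ =>
    (integrableOn_exp_mul_complex_Ioi (by simpa using ha) 0).const_mul _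

lemma integral_exp_neg_mul_trigSum (ha : 0 < a) :
    ∫ t in Ioi (0 : ℝ), (exp (-a * t) : ℂ) * trigSum w ω t =
      ∑ i, w i / (a - Complex.I * ω i) := by
  simp_rw [exp_neg_mul_trigSum]
  rw [integral_finsetSum _ fun i _ =>
    (integrableOn_exp_mul_complex_Ioi (by simpa using ha) 0).const_mul _]
  refine Finset.sum_congr rfl fun i _ => ?_
  rw [integral_const_mul, integral_exp_mul_complex_Ioi (by simpa using ha)]
  simp only [Complex.ofReal_zero, mul_zero, Complex.exp_zero]
  rw [show (-a + Complex.I * ω i : ℂ) = -(a - Complex.I * ω i) by ring, neg_div_neg_eq, one_div,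
    div_eq_mul_inv]

lemma integrableOn_exp_neg_mul_norm_trigSum (ha : 0 < a) :
    IntegrableOn (fun t : ℝ => exp (-a * t) * (‖trigSum w ω t‖ + ‖trigSum w ω (-t)‖))
      (Ioi 0) := by
  have h1 := (integrableOn_exp_neg_mul_trigSum w ω ha).norm
  have h2 := (integrableOn_exp_neg_mul_trigSum w (-ω) ha).norm
  refine (h1.add h2).congr (Filter.Eventually.of_forall fun t => ?_)
  simp only [Pi.add_apply, norm_mul, Complex.norm_real, Real.norm_of_nonneg (exp_pos _).le,
    trigSum_neg, ← mul_add]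

lemma norm_sum_div_add_norm_sum_div_le (ha : 0 < a) :
    ‖∑ i, w i / (a - Complex.I * ω i)‖ + ‖∑ i, w i / (a + Complex.I * ω i)‖ ≤
      ∫ t in Ioi (0 : ℝ), exp (-a * t) * (‖trigSum w ω t‖ + ‖trigSum w ω (-t)‖) := by
  have h1 := integrableOn_exp_neg_mul_trigSum w ω ha
  have h2 := integrableOn_exp_neg_mul_trigSum w (-ω) ha
  have e : ∑ i, w i / (a + Complex.I * ω i) = ∑ i, w i / (a - Complex.I * ((-ω) i : ℝ)) := by
    simp
  rw [e, ← integral_exp_neg_mul_trigSum w ω ha, ← integral_exp_neg_mul_trigSum w (-ω) ha]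
  refine (add_le_add (norm_integral_le_integral_norm _) (norm_integral_le_integral_norm _)).trans
    (le_of_eq ?_)
  rw [← integral_add h1.norm h2.norm]
  refine integral_congr_ae (Filter.Eventually.of_forall fun t => ?_)
  simp only [norm_mul, Complex.norm_real, Real.norm_of_nonneg (exp_pos _).le,
    trigSum_neg, ← mul_add]

/-- The term of the Fourier expansion that belongs to the frequencies `n` and `-n`. -/
noncomputable def pairTerm (x α : ℝ) (n : ℕ) : ℂ :=
  x / (2 * π * Complex.I * (n : ℤ) * (x - 2 * π * Complex.I * (n : ℤ))) *
      (Complex.exp (2 * π * Complex.I * (n : ℤ) * α) - 1) +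
    x / (2 * π * Complex.I * (-n : ℤ) * (x - 2 * π * Complex.I * (-n : ℤ))) *
      (Complex.exp (2 * π * Complex.I * (-n : ℤ) * α) - 1)

/-- Partial fractions, x/(p(x - p)) = 1/(x - p) + 1/p with p = ±2πin. The first part is a Laplace
transform of an exponential in the frequency y; the second does not depend on y. -/
lemma pairTerm_eq {β : ℝ} (hβ : 0 < β) (y α : ℝ) {n : ℕ} (hn : n ≠ 0) :
    pairTerm (β * y) α n =
      (Complex.exp (2 * π * Complex.I * n * α) - 1) *
        (Complex.I / β * (1 / ((2 * π / β * n : ℝ) + Complex.I * y)) +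
          1 / (2 * π * Complex.I * n)) +
      (Complex.exp (-(2 * π * Complex.I * n * α)) - 1) *
        (-Complex.I / β * (1 / ((2 * π / β * n : ℝ) - Complex.I * y)) -
          1 / (2 * π * Complex.I * n)) := by
  have hn' : (0 : ℝ) < n := Nat.cast_pos.2 (Nat.pos_of_ne_zero hn)
  have hpos : 0 < 2 * π / β * n := by positivity
  have hβ' : (β : ℂ) ≠ 0 := by exact_mod_cast hβ.ne'
  have hπ : (π : ℂ) ≠ 0 := by exact_mod_cast Real.pi_ne_zero
  have hnc : (n : ℂ) ≠ 0 := by exact_mod_cast hn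
  have h1 : ((2 * π / β * n : ℝ) : ℂ) + Complex.I * y ≠ 0 := fun h => by
    have := congrArg Complex.re h
    rw [Complex.add_re, Complex.ofReal_re, Complex.re_mul_ofReal, Complex.I_re, zero_mul, add_zero,
      Complex.zero_re] at this
    exact hpos.ne' this
  have h2 : ((2 * π / β * n : ℝ) : ℂ) - Complex.I * y ≠ 0 := fun h => by
    have := congrArg Complex.re h
    rw [Complex.sub_re, Complex.ofReal_re, Complex.re_mul_ofReal, Complex.I_re, zero_mul, sub_zero,
      Complex.zero_re] at this
    exact hpos.ne' this
  have hp : 2 * π * Complex.I * n ≠ 0 := by simp [hn, Real.pi_ne_zero]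
  have e1 : ((β * y : ℝ) : ℂ) - 2 * π * Complex.I * n =
      -Complex.I * β * ((2 * π / β * n : ℝ) + Complex.I * y) := by
    push_cast
    field_simp
    linear_combination (y : ℂ) * β * Complex.I_sq
  have e2 : ((β * y : ℝ) : ℂ) + 2 * π * Complex.I * n =
      Complex.I * β * ((2 * π / β * n : ℝ) - Complex.I * y) := by
    push_cast
    field_simp
    linear_combination (y : ℂ) * β * Complex.I_sq
  have partial_fractions : ∀ p X : ℂ, p ≠ 0 → X ≠ 0 → (X + p) / (p * X) = 1 / X + 1 / p := by
    intro p X hp hX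
    field_simp
    ring
  have f1 : ((β * y : ℝ) : ℂ) / (2 * π * Complex.I * n *
      (((β * y : ℝ) : ℂ) - 2 * π * Complex.I * n)) =
      Complex.I / β * (1 / ((2 * π / β * n : ℝ) + Complex.I * y)) +
        1 / (2 * π * Complex.I * n) := by
    have h := partial_fractions _ (((β * y : ℝ) : ℂ) - 2 * π * Complex.I * n) hp
      (by rw [e1]; exact mul_ne_zero (mul_ne_zero (neg_ne_zero.2 Complex.I_ne_zero) hβ') h1)
    rw [sub_add_cancel] at h
    rw [h, e1]
    congr 1
    rw [one_div, mul_inv, mul_inv, inv_neg, Complex.inv_I, neg_neg]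
    ring
  have f2 : ((β * y : ℝ) : ℂ) / (-(2 * π * Complex.I * n) *
      (((β * y : ℝ) : ℂ) + 2 * π * Complex.I * n)) =
      -Complex.I / β * (1 / ((2 * π / β * n : ℝ) - Complex.I * y)) -
        1 / (2 * π * Complex.I * n) := by
    have h := partial_fractions _ (((β * y : ℝ) : ℂ) + 2 * π * Complex.I * n) (neg_ne_zero.2 hp)
      (by rw [e2]; exact mul_ne_zero (mul_ne_zero Complex.I_ne_zero hβ') h2)
    rw [add_neg_cancel_right] at h
    rw [h, e2, one_div (-(2 * π * Complex.I * n)), inv_neg, ← sub_eq_add_neg, one_div (2 * _ * _ * _)]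
    congr 1
    rw [one_div, mul_inv, mul_inv, Complex.inv_I]
    ring
  rw [pairTerm, ← f1, ← f2]
  push_cast
  ring_nf

lemma norm_exp_sub_one_le_two (s : ℝ) : ‖Complex.exp (s * Complex.I) - 1‖ ≤ 2 := by
  refine (norm_sub_le _ _).trans ?_
  rw [Complex.norm_exp_ofReal_mul_I, norm_one]
  norm_num

variable {w ω}

lemma norm_sum_mul_pairTerm_le {β : ℝ} (hβ : 0 < β) (hw : ∑ i, w i = 0) (α : ℝ) {n : ℕ}
    (hn : n ≠ 0) :
    ‖∑ i, w i * pairTerm (β * ω i) α n‖ ≤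
      2 / β * ∫ t in Ioi (0 : ℝ), exp (-(2 * π / β * n) * t) *
        (‖trigSum w ω t‖ + ‖trigSum w ω (-t)‖) := by
  have hn' : (0 : ℝ) < n := Nat.cast_pos.2 (Nat.pos_of_ne_zero hn)
  have hpos : 0 < 2 * π / β * n := by positivity
  set c : ℝ := 2 * π / β * n with hc
  set z₁ := Complex.exp (2 * π * Complex.I * n * α) - 1
  set z₂ := Complex.exp (-(2 * π * Complex.I * n * α)) - 1
  have hz₁ : ‖z₁‖ ≤ 2 := by
    have := norm_exp_sub_one_le_two (2 * π * n * α)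
    rwa [show ((2 * π * n * α : ℝ) : ℂ) * Complex.I = 2 * π * Complex.I * n * α by
      push_cast; ring] at this
  have hz₂ : ‖z₂‖ ≤ 2 := by
    have := norm_exp_sub_one_le_two (-(2 * π * n * α))
    rwa [show ((-(2 * π * n * α) : ℝ) : ℂ) * Complex.I = -(2 * π * Complex.I * n * α) by
      push_cast; ring] at this
  have e : ∑ i, w i * pairTerm (β * ω i) α n =
      z₁ * (Complex.I / β) * ∑ i, w i / (c + Complex.I * ω i) +
        z₂ * (-Complex.I / β) * ∑ i, w i / (c - Complex.I * ω i) := by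
    -- The last summand has a coefficient independent of i, so it disappears on summation by ∑ w =
    -- 0.
    have : ∀ i, w i * pairTerm (β * ω i) α n =
        z₁ * (Complex.I / β) * (w i / (c + Complex.I * ω i)) +
        z₂ * (-Complex.I / β) * (w i / (c - Complex.I * ω i)) +
        (z₁ - z₂) / (2 * π * Complex.I * n) * w i := fun i => by
      rw [pairTerm_eq hβ (ω i) α hn]
      ring
    simp_rw [this]
    rw [Finset.sum_add_distrib, Finset.sum_add_distrib, ← Finset.mul_sum, ← Finset.mul_sum,
      ← Finset.mul_sum, hw, mul_zero, add_zero]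
  have hIβ : ‖Complex.I / (β : ℂ)‖ = 1 / β := by
    rw [norm_div, Complex.norm_I, Complex.norm_real, Real.norm_of_nonneg hβ.le]
  have hIβ' : ‖-Complex.I / (β : ℂ)‖ = 1 / β := by
    rw [neg_div, norm_neg, hIβ]
  rw [e]
  calc _ ≤ 2 * (1 / β) * ‖∑ i, w i / (c + Complex.I * ω i)‖ +
        2 * (1 / β) * ‖∑ i, w i / (c - Complex.I * ω i)‖ := by
        refine (norm_add_le _ _).trans ?_
        rw [norm_mul, norm_mul, norm_mul, norm_mul, hIβ, hIβ']
        gcongr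
    _ = 2 / β * (‖∑ i, w i / (c - Complex.I * ω i)‖ + ‖∑ i, w i / (c + Complex.I * ω i)‖) := by
        ring
    _ ≤ _ := mul_le_mul_of_nonneg_left (norm_sum_div_add_norm_sum_div_le w ω hpos) (by positivity)

/-- Partial sums of a geometric series with ratio `exp (-s)`. -/
lemma sum_range_exp_neg_le {s : ℝ} (hs : 0 < s) (N : ℕ) :
    ∑ m ∈ Finset.range N, exp (-(m + 1 : ℕ) * s) ≤ exp (-s) / (1 - exp (-s)) := by
  have hq : exp (-s) < 1 := exp_lt_one_iff.2 (by linarith)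
  have e : ∀ m : ℕ, exp (-(m + 1 : ℕ) * s) = exp (-s) * exp (-s) ^ m := fun m => by
    rw [← exp_nat_mul, ← exp_add]
    congr 1
    push_cast
    ring
  simp_rw [e]
  rw [← Finset.mul_sum, div_eq_mul_inv]
  refine mul_le_mul_of_nonneg_left ?_ (exp_pos _).le
  rw [← tsum_geometric_of_lt_one (exp_pos _).le hq]
  exact (summable_geometric_of_lt_one (exp_pos _).le hq).sum_le_tsum _ fun m _ => by positivity

lemma exp_neg_div_one_sub_le {s : ℝ} (hs : 0 < s) : exp (-s) / (1 - exp (-s)) ≤ 1 / s := by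
  have hq : 0 < 1 - exp (-s) := sub_pos.2 (exp_lt_one_iff.2 (by linarith))
  rw [div_le_div_iff₀ hq hs]
  have h1 := add_one_le_exp s
  have h2 : exp (-s) * exp s = 1 := by rw [← exp_add, neg_add_cancel, exp_zero]
  nlinarith [exp_pos (-s)]

/-- The factor s cancels the singularity 1/s of the geometric kernel at short times. -/
lemma exp_sub_one_le_mul_exp (s : ℝ) : exp s - 1 ≤ s * exp s := by
  have h1 := add_one_le_exp (-s)
  have h2 : exp (-s) * exp s = 1 := by rw [← exp_add, neg_add_cancel, exp_zero]
  nlinarith [exp_pos s]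

/-- The integral of the geometric kernel against a function that is small at short times and
bounded at long times. -/
lemma sum_integral_exp_neg_mul_le {Ψ : ℝ → ℝ} (hΨ0 : ∀ t, 0 ≤ Ψ t) {c F v t₀ : ℝ} (hc : 0 < c)
    (hF : 0 ≤ F) (ht₀ : 0 < t₀)
    (hint : ∀ m : ℕ, IntegrableOn (fun t => exp (-(c * (m + 1 : ℕ)) * t) * Ψ t) (Ioi 0))
    (hlong : ∀ t, Ψ t ≤ 4) (hshort : ∀ t, 0 < t → Ψ t ≤ 2 * F * (exp (v * t) - 1)) (N : ℕ) :
    ∑ m ∈ Finset.range N, ∫ t in Ioi (0 : ℝ), exp (-(c * (m + 1 : ℕ)) * t) * Ψ t ≤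
      1 / c * (2 * F * (exp (v * t₀) - 1) + 4 * (exp (-(c * t₀)) / (1 - exp (-(c * t₀))))) := by
  let S : ℝ → ℝ := fun t => ∑ m ∈ Finset.range N, exp (-(c * (m + 1 : ℕ)) * t)
  have hS : ∀ t, 0 < t → S t ≤ exp (-(c * t)) / (1 - exp (-(c * t))) := fun t ht => by
    refine le_trans (le_of_eq ?_) (sum_range_exp_neg_le (mul_pos hc ht) N)
    refine Finset.sum_congr rfl fun m _ => ?_
    congr 1
    ring
  have hG : IntegrableOn (fun t => S t * Ψ t) (Ioi 0) := by
    simp only [S, Finset.sum_mul]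
    exact integrable_finsetSum _ fun m _ => hint m
  have hsum : ∑ m ∈ Finset.range N, ∫ t in Ioi (0 : ℝ), exp (-(c * (m + 1 : ℕ)) * t) * Ψ t =
      ∫ t in Ioi (0 : ℝ), S t * Ψ t := by
    simp only [S, Finset.sum_mul]
    rw [integral_finsetSum _ fun m _ => hint m]
  rw [hsum, ← Ioc_union_Ioi_eq_Ioi ht₀.le, setIntegral_union (Ioc_disjoint_Ioi le_rfl)
    measurableSet_Ioi (hG.mono_set Ioc_subset_Ioi_self)
    (hG.mono_set (Ioi_subset_Ioi ht₀.le)), mul_add]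
  refine add_le_add ?_ ?_
  · have hderiv : ∀ t ∈ uIcc 0 t₀, HasDerivAt (fun t => 2 * F / c * exp (v * t))
        (2 * F / c * (v * exp (v * t))) t := fun t _ => by
      have h1 : HasDerivAt (fun t : ℝ => v * t) v t := by
        simpa using (hasDerivAt_id t).const_mul v
      refine (h1.exp.const_mul _).congr_deriv ?_
      ring
    have hval : ∫ t in Ioc 0 t₀, 2 * F / c * (v * exp (v * t)) =
        1 / c * (2 * F * (exp (v * t₀) - 1)) := by
      rw [← intervalIntegral.integral_of_le ht₀.le,
        intervalIntegral.integral_eq_sub_of_hasDerivAt hderiv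
          (Continuous.intervalIntegrable (by fun_prop) _ _)]
      simp only [mul_zero, exp_zero]
      ring
    rw [← hval]
    refine setIntegral_mono_on (hG.mono_set Ioc_subset_Ioi_self)
      (Continuous.integrableOn_Ioc (by fun_prop)) measurableSet_Ioc fun t ht => ?_
    have h1 := (hS t ht.1).trans (exp_neg_div_one_sub_le (mul_pos hc ht.1))
    have h2 : Ψ t ≤ 2 * F * (v * t * exp (v * t)) := (hshort t ht.1).trans
      (mul_le_mul_of_nonneg_left (exp_sub_one_le_mul_exp _) (by positivity))
    have hct : 0 < c * t := mul_pos hc ht.1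
    calc S t * Ψ t ≤ 1 / (c * t) * (2 * F * (v * t * exp (v * t))) :=
          mul_le_mul h1 h2 (hΨ0 t) (by positivity)
      _ = _ := by
        have := ht.1.ne'
        field_simp
  · have hq₀ : 0 < 1 - exp (-(c * t₀)) :=
      sub_pos.2 (exp_lt_one_iff.2 (neg_lt_zero.2 (mul_pos hc ht₀)))
    have hval : ∫ t in Ioi t₀, 4 / (1 - exp (-(c * t₀))) * exp (-c * t) =
        1 / c * (4 * (exp (-(c * t₀)) / (1 - exp (-(c * t₀))))) := by
      rw [integral_const_mul, integral_exp_mul_Ioi (neg_lt_zero.2 hc), neg_mul]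
      field_simp
    rw [← hval]
    refine setIntegral_mono_on (hG.mono_set (Ioi_subset_Ioi ht₀.le))
      ((integrableOn_exp_mul_Ioi (neg_lt_zero.2 hc) t₀).const_mul _) measurableSet_Ioi
      fun t ht => ?_
    have ht' : t₀ < t := ht
    have htpos : 0 < t := ht₀.trans ht'
    have h1 : exp (-(c * t)) ≤ exp (-(c * t₀)) :=
      exp_le_exp.2 (neg_le_neg (mul_le_mul_of_nonneg_left ht'.le hc.le))
    have h2 : S t ≤ exp (-(c * t)) / (1 - exp (-(c * t₀))) :=
      (hS t htpos).trans (div_le_div_of_nonneg_left (exp_pos _).le hq₀ (by linarith))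
    -- Beyond t₀ the denominator of the kernel is frozen at its value at t₀, leaving an exponential
    -- to integrate.
    calc S t * Ψ t ≤ exp (-(c * t)) / (1 - exp (-(c * t₀))) * 4 :=
          mul_le_mul h2 (hlong t) (hΨ0 t) (by positivity)
      _ = _ := by rw [neg_mul]; ring

/-- The thermal filter `(exp (αβω) - 1) / (exp (βω) - 1)` applied to a trigonometric sum that is
small at short times. -/
lemma norm_sum_thermal_filter_le {β α F v t₀ : ℝ} (hβ : 0 < β) (h0 : 0 ≤ α) (h1 : α ≤ 1)
    (hF : 0 ≤ F) (ht₀ : 0 < t₀) (hw : ∑ i, w i = 0) (hwω : ∀ i, ω i = 0 → w i = 0)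
    (hlong : ∀ t, ‖trigSum w ω t‖ ≤ 2)
    (hshort : ∀ t, ‖trigSum w ω t‖ ≤ F * (exp (v * |t|) - 1)) :
    ‖∑ i, w i * ((Complex.exp ((β * ω i : ℝ) * α) - 1) / (Complex.exp (β * ω i : ℝ) - 1))‖ ≤
      1 / π * (2 * F * (exp (v * t₀) - 1) +
        4 * (exp (-(2 * π / β * t₀)) / (1 - exp (-(2 * π / β * t₀))))) := by
  have hsum : HasSum (fun n : ℕ => ∑ i, w i * pairTerm (β * ω i) α n)
      (∑ i, w i * ((Complex.exp ((β * ω i : ℝ) * α) - 1) / (Complex.exp (β * ω i : ℝ) - 1))) := by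
    have hα : ∑ i, w i * ((Complex.exp ((β * ω i : ℝ) * α) - 1) /
        (Complex.exp (β * ω i : ℝ) - 1)) =
        -- Subtracting α is free because the weights sum to zero; it makes the filter periodic in α.
        ∑ i, w i * ((Complex.exp ((β * ω i : ℝ) * α) - 1) /
          (Complex.exp (β * ω i : ℝ) - 1) - α) := by
      simp_rw [mul_sub, Finset.sum_sub_distrib, ← Finset.sum_mul, hw, zero_mul, sub_zero]
    rw [hα]
    refine hasSum_sum fun i _ => ?_
    rcases eq_or_ne (ω i) 0 with hi | hi
    · simp only [hwω i hi, zero_mul]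
      exact hasSum_zero
    · have h := (hasSum_exp_sub_id (mul_ne_zero hβ.ne' hi) h0 h1).nat_add_neg
      simp only [Int.cast_zero, mul_zero, zero_mul, div_zero, add_zero] at h
      exact h.mul_left (w i)
  have hzero : ∑ i, w i * pairTerm (β * ω i) α 0 = 0 := by
    simp [pairTerm]
  have htends := (Filter.tendsto_add_atTop_iff_nat 1).2 hsum.tendsto_sum_nat
  refine le_of_tendsto' htends.norm fun N => ?_
  rw [Finset.sum_range_succ', hzero, add_zero]
  have hc : 0 < 2 * π / β := by positivity
  calc ‖∑ m ∈ Finset.range N, ∑ i, w i * pairTerm (β * ω i) α (m + 1)‖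
      ≤ ∑ m ∈ Finset.range N, 2 / β * ∫ t in Ioi (0 : ℝ),
          exp (-(2 * π / β * (m + 1 : ℕ)) * t) * (‖trigSum w ω t‖ + ‖trigSum w ω (-t)‖) :=
        (norm_sum_le _ _).trans (Finset.sum_le_sum fun m _ =>
          norm_sum_mul_pairTerm_le hβ hw α m.succ_ne_zero)
    _ ≤ 2 / β * (1 / (2 * π / β) * (2 * F * (exp (v * t₀) - 1) +
          4 * (exp (-(2 * π / β * t₀)) / (1 - exp (-(2 * π / β * t₀)))))) := by
        rw [← Finset.mul_sum]
        refine mul_le_mul_of_nonneg_left ?_ (by positivity)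
        refine sum_integral_exp_neg_mul_le (fun t => by positivity) hc hF ht₀
          (fun m => integrableOn_exp_neg_mul_norm_trigSum w ω (by positivity))
          (fun t => by linarith [hlong t, hlong (-t)]) (fun t ht => ?_) N
        have e1 := hshort t
        have e2 := hshort (-t)
        rw [abs_neg] at e2
        rw [abs_of_pos ht] at e1 e2
        linarith
    _ = _ := by field_simp

end TrigonometricSums

/-! ### From Lieb–Robinson constants to clustering. -/

section Clustering

variable {Λ : Type u} [Fintype Λ] [DecidableEq Λ] {d₀ : ℕ} {G : SimpleGraph Λ}

lemma exp_half_bounds : 0.6 ≤ exp (-(1 / 2)) ∧ exp (-(1 / 2)) ≤ 0.61 := by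
  have h1 : exp (-(1 / 2)) * exp (-(1 / 2)) * exp 1 = 1 := by
    rw [← exp_add, ← exp_add]
    norm_num
  have h2 := exp_one_gt_d9
  have h3 := exp_one_lt_d9
  have h4 := exp_pos (-(1 / 2))
  constructor <;> nlinarith

/-- Short distances: 12/π > 3.8 and exp(-1/2) ≥ 0.6 already give more than the trivial bound 2. -/
lemma two_le_clusterConst_mul {C v β s m : ℝ} (hC : 0 < C) (hv : 0 < v) (hβ : 0 < β)
    (hs : s ≤ 1) (hm : 1 ≤ m) : 2 ≤ clusterConst C v β * m * exp (-(s / 2)) := by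
  have h1 : 3.8 ≤ clusterConst C v β := by
    have h2 : 3.8 ≤ (12 + 2 * C) / π := by
      rw [le_div_iff₀ pi_pos]
      nlinarith [pi_lt_d2]
    have h3 : 0 ≤ 4 * C / (v * β) := by positivity
    unfold clusterConst
    linarith
  have h2 : 0.6 ≤ exp (-(s / 2)) := exp_half_bounds.1.trans (exp_le_exp.2 (by linarith))
  have h3 : 3.8 ≤ clusterConst C v β * m := by nlinarith
  nlinarith

/-- With y = exp(-s/2) ≤ 0.61 one has y²/(1 - y²) ≤ 3y, which produces the 12 in the constant, and
y² ≤ y produces 2C. The summand 4C/(vβ) is spare. -/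
lemma filter_bound_le_clusterConst {C v β s m : ℝ} (hC : 0 < C) (hv : 0 < v) (hβ : 0 < β)
    (hs : 1 ≤ s) (hm : 1 ≤ m) :
    1 / π * (2 * (C * m * exp (-s)) + 4 * (exp (-s) / (1 - exp (-s)))) ≤
      clusterConst C v β * m * exp (-(s / 2)) := by
  have hsq : exp (-s) = exp (-(s / 2)) * exp (-(s / 2)) := by
    rw [← exp_add]; congr 1; ring
  have hy0 := exp_pos (-(s / 2))
  have hy1 : exp (-(s / 2)) ≤ 0.61 := (exp_le_exp.2 (by linarith)).trans exp_half_bounds.2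
  rw [hsq]
  set y := exp (-(s / 2))
  have hden : 0 < 1 - y * y := by nlinarith
  have h1 : y * y / (1 - y * y) ≤ 3 * y := by
    rw [div_le_iff₀ hden]
    nlinarith
  have h2 : 3 * y ≤ 3 * (m * y) := by nlinarith
  have h3 : C * m * (y * y) ≤ C * m * y :=
    mul_le_mul_of_nonneg_left (by nlinarith) (by positivity)
  have h4 : clusterConst C v β * m * y =
      1 / π * ((12 + 2 * C) * (m * y)) + 4 * C / (v * β) * m * y := by
    unfold clusterConst
    ring
  have h5 : 0 ≤ 4 * C / (v * β) * m * y := by positivity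
  rw [h4]
  refine (mul_le_mul_of_nonneg_left ?_ (by positivity)).trans (le_add_of_nonneg_right h5)
  nlinarith

/-- By detailed balance p_k = p_j exp(βω), both 1 - exp(αβω) and p_j - p_k are multiples of p_j, and
their quotient is the filter. For ω = 0 both sides vanish, whatever value the quotient takes. -/
lemma wydCorrelation_representation_sub {E : (Λ → Fin d₀) → ℝ} {β : ℝ} (hβ : 0 < β)
    (A B : SpinOp Λ d₀) (α : ℝ) :
    (Matrix.diagonal (fun j => (gibbsWeight E β j : ℂ)) * (A * B)).trace -
        ∑ j, ∑ k, ((gibbsWeight E β j ^ (1 - α) : ℝ) : ℂ) * ((gibbsWeight E β k ^ α : ℝ) : ℂ) *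
          (A j k * B k j) =
      ∑ i : (Λ → Fin d₀) × (Λ → Fin d₀),
        ((gibbsWeight E β i.1 - gibbsWeight E β i.2 : ℝ) : ℂ) * (A i.1 i.2 * B i.2 i.1) *
          ((Complex.exp ((β * (E i.1 - E i.2) : ℝ) * α) - 1) /
            (Complex.exp (β * (E i.1 - E i.2) : ℝ) - 1)) := by
  have h1 : (Matrix.diagonal (fun j => (gibbsWeight E β j : ℂ)) * (A * B)).trace =
      ∑ j, ∑ k, (gibbsWeight E β j : ℂ) * (A j k * B k j) := by
    simp only [Matrix.trace, Matrix.diag, Matrix.diagonal_mul]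
    simp only [Matrix.mul_apply, Finset.mul_sum]
  rw [h1, Fintype.sum_prod_type, ← Finset.sum_sub_distrib]
  refine Finset.sum_congr rfl fun j _ => ?_
  rw [← Finset.sum_sub_distrib]
  refine Finset.sum_congr rfl fun k _ => ?_
  rw [← Complex.ofReal_mul, gibbsWeight_rpow_mul_rpow, gibbsWeight_eq_mul E β j k]
  rcases eq_or_ne (E j - E k) 0 with h | h
  · simp [h]
  · have hne := complex_exp_sub_one_ne_zero (mul_ne_zero hβ.ne' h)
    push_cast at hne ⊢
    rw [mul_comm (α : ℂ)]
    field_simp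
    ring

/-- Gibbs weights are strictly positive, so their powers depend continuously on the exponent. -/
lemma continuous_wydCorrelation {H : SpinOp Λ d₀} (hH : H.IsHermitian) (β : ℝ)
    (OA OB : SpinOp Λ d₀) :
    Continuous fun α : ℝ => wydCorrelation (gibbsState H β) α OA OB := by
  obtain ⟨E, A, B, -, -, hQ, -⟩ := exists_eigenbasis_representation hH β OA OB
  simp_rw [hQ]
  refine continuous_const.sub (continuous_finsetSum _ fun j _ => continuous_finsetSum _ fun k _ =>
    (Continuous.mul ?_ ?_).mul continuous_const)
  · exact Complex.continuous_ofReal.comp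
      (continuous_const.rpow (by fun_prop) fun _ => Or.inl (gibbsWeight_pos E β j).ne')
  · exact Complex.continuous_ofReal.comp
      (continuous_const.rpow continuous_id fun _ => Or.inl (gibbsWeight_pos E β k).ne')

/-- Clustering of the Wigner–Yanase–Dyson correlation from a Lieb–Robinson bound. -/
theorem norm_wydCorrelation_le (hG : G.Connected) (hd : 1 ≤ d₀) {H : SpinOp Λ d₀}
    (hH : H.IsHermitian) {C v μ β : ℝ} (hC : 0 < C) (hv : 0 < v) (hμ : 0 < μ) (hβ : 0 < β)
    (hLR : LiebRobinsonBound G H C v μ) {A B : Finset Λ} (hA : A.Nonempty) (hB : B.Nonempty)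
    (hA' : A ≠ Finset.univ) (hB' : B ≠ Finset.univ) {OA OB : SpinOp Λ d₀}
    (hOA : SupportedOn A OA) (hOB : SupportedOn B OB) (hA1 : ‖OA‖ = 1) (hB1 : ‖OB‖ = 1)
    {α : ℝ} (h0 : 0 ≤ α) (h1 : α ≤ 1) :
    ‖wydCorrelation (gibbsState H β) α OA OB‖ ≤
      clusterConst C v β * (min (surface G A).card (surface G B).card : ℕ) *
        exp (-(siteDist G A B : ℝ) / clusterLength v μ β) := by
  have : NeZero d₀ := ⟨by omega⟩
  obtain ⟨E, A', B', hA'n, hB'n, hQ, hcomm⟩ := exists_eigenbasis_representation hH β OA OB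
  have hp : ∀ j, 0 ≤ gibbsWeight E β j := fun j => (gibbsWeight_pos E β j).le
  have hp1 := sum_gibbsWeight E β
  set R : ℝ := (siteDist G A B : ℝ) with hR
  set m : ℝ := ((min (surface G A).card (surface G B).card : ℕ) : ℝ) with hm_def
  have hm : 1 ≤ m := by
    rw [hm_def]
    exact_mod_cast le_min (one_le_card_surface hG hA hA') (one_le_card_surface hG hB hB')
  -- `s` is twice R/ξ', and is the common exponent of the short- and long-time contributions once
  -- the cut is balanced.
  set s : ℝ := μ * R / (1 + v * β / (2 * π)) with hs_def
  have hden : 0 < 1 + v * β / (2 * π) := by positivity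
  have hexp : -R / clusterLength v μ β = -(s / 2) := by
    rw [hs_def, clusterLength]
    have : 2 + v * β / π = 2 * (1 + v * β / (2 * π)) := by
      field_simp
    rw [this]
    field_simp
  rw [hexp]
  rcases le_total s 1 with hs | hs
  · refine le_trans ?_ (two_le_clusterConst_mul hC hv hβ hs hm)
    rw [hQ]
    have e1 := norm_trace_diagonal_mul_le hp hp1 (A' * B')
    have e2 := norm_sum_rpow_mul_le hp hp1 (hA'n.trans hA1).le (hB'n.trans hB1).le h0 h1
    have e3 := norm_mul_le A' B'
    rw [hA'n, hB'n, hA1, hB1] at e3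
    refine (norm_sub_le _ _).trans ?_
    linarith
  -- Overlapping supports have s = 0, so here the distance is positive and the Lieb–Robinson bound
  -- applies.
  · have hRpos : 0 < siteDist G A B := by
      rw [Nat.pos_iff_ne_zero]
      intro h
      rw [hs_def, hR, h] at hs
      norm_num at hs
    let w : (Λ → Fin d₀) × (Λ → Fin d₀) → ℂ := fun i =>
      ((gibbsWeight E β i.1 - gibbsWeight E β i.2 : ℝ) : ℂ) * (A' i.1 i.2 * B' i.2 i.1)
    let ω : (Λ → Fin d₀) × (Λ → Fin d₀) → ℝ := fun i => E i.1 - E i.2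
    have htrig : ∀ t, ‖trigSum w ω t‖ ≤
        ‖timeEvolution H OA t * OB - OB * timeEvolution H OA t‖ := fun t => by
      obtain ⟨X, hX, hXtr⟩ := hcomm t
      have : trigSum w ω t =
          (Matrix.diagonal (fun j => (gibbsWeight E β j : ℂ)) * X).trace := by
        rw [hXtr, trigSum, Fintype.sum_prod_type]
      rw [this, ← hX]
      exact norm_trace_diagonal_mul_le hp hp1 X
    have hlong : ∀ t, ‖trigSum w ω t‖ ≤ 2 := fun t => by
      have := norm_commutator_le (timeEvolution H OA t) OB
      rw [norm_timeEvolution hH, hA1, hB1] at this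
      linarith [htrig t]
    have hshort : ∀ t, ‖trigSum w ω t‖ ≤ C * m * exp (-μ * R) * (exp (v * |t|) - 1) := fun t => by
      refine (htrig t).trans ((hLR A B hA hB hRpos OA OB hOA hOB hA1 hB1 t).trans (le_of_eq ?_))
      ring
    -- The Lieb–Robinson bound at t = 0.
    have hw : ∑ i, w i = 0 := by
      have := hshort 0
      rw [abs_zero, mul_zero, exp_zero, sub_self, mul_zero] at this
      simpa [trigSum] using this
    have hwω : ∀ i, ω i = 0 → w i = 0 := fun i hi => by
      have hi : E i.1 = E i.2 := sub_eq_zero.1 hi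
      simp [w, gibbsWeight, hi]
    have hspos : 0 < s := by linarith
    -- The cut t₀ = sβ/2π solves (2π/β) t₀ = μR - v t₀.
    have hbound := norm_sum_thermal_filter_le (t₀ := s * β / (2 * π)) hβ h0 h1
      (by positivity) (by positivity) hw hwω hlong hshort
    have hQ' : wydCorrelation (gibbsState H β) α OA OB =
        ∑ i, w i * ((Complex.exp ((β * ω i : ℝ) * α) - 1) /
          (Complex.exp (β * ω i : ℝ) - 1)) := by
      rw [hQ, wydCorrelation_representation_sub hβ]
    rw [hQ']
    refine hbound.trans (le_trans ?_ (filter_bound_le_clusterConst hC hv hβ hs hm))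
    have e1 : 2 * π / β * (s * β / (2 * π)) = s := by
      field_simp
    have e2 : exp (-μ * R) * exp (v * (s * β / (2 * π))) = exp (-s) := by
      rw [← exp_add]
      congr 1
      have : s * (1 + v * β / (2 * π)) = μ * R := div_mul_cancel₀ _ hden.ne'
      linear_combination this
    rw [e1]
    have e3 : C * m * exp (-μ * R) * (exp (v * (s * β / (2 * π))) - 1) ≤ C * m * exp (-s) := by
      rw [mul_sub, mul_assoc, e2, mul_one]
      have : 0 ≤ C * m * exp (-μ * R) := by positivity
      linarith
    refine mul_le_mul_of_nonneg_left ?_ (by positivity)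
    linarith

end Clustering

/-! ### Uniform constants, pointwise clustering and the average over α. -/

theorem mainTheorem5 (D k : ℕ) (γ g g₀ μ₀ : ℝ) (hD : 1 ≤ D) (hγ : 1 ≤ γ)
    (hg : 0 < g) (hg₀ : 0 < g₀) (hμ₀ : 0 < μ₀) :
    -- there are Lieb-Robinson constants that depend only on `D, k, γ, g, g₀, μ₀`
    ∃ C v μ : ℝ, 0 < C ∧ 0 < v ∧ 0 < μ ∧
      ∀ (Λ : Type u) [Fintype Λ] [DecidableEq Λ] (d₀ : ℕ) (G : SimpleGraph Λ)
        (h : Finset Λ → SpinOp Λ d₀),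
        1 ≤ d₀ → IsLattice G D γ → IsShortRange G h k g g₀ μ₀ →
        LiebRobinsonBound G (hamiltonian h) C v μ ∧
        -- the clustering bound holds with these, and with any other, Lieb-Robinson constants
        ∀ C' v' μ' : ℝ, 0 < C' → 0 < v' → 0 < μ' →
          LiebRobinsonBound G (hamiltonian h) C' v' μ' →
          ∀ (β : ℝ), 0 < β →
          ∀ (A B : Finset Λ), A.Nonempty → B.Nonempty → A ≠ Finset.univ → B ≠ Finset.univ →
          ∀ (OA OB : SpinOp Λ d₀), SupportedOn A OA → SupportedOn B OB → ‖OA‖ = 1 → ‖OB‖ = 1 →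
            (∀ α : ℝ, 0 ≤ α → α ≤ 1 →
              ‖wydCorrelation (gibbsState (hamiltonian h) β) α OA OB‖ ≤
                clusterConst C' v' β * (min (surface G A).card (surface G B).card : ℕ) *
                  exp (-(siteDist G A B : ℝ) / clusterLength v' μ' β)) ∧
            IntervalIntegrable
              (fun α : ℝ => wydCorrelation (gibbsState (hamiltonian h) β) α OA OB)
              MeasureTheory.volume 0 1 ∧
            ‖∫ α in (0 : ℝ)..1, wydCorrelation (gibbsState (hamiltonian h) β) α OA OB‖ ≤
              clusterConst C' v' β * (min (surface G A).card (surface G B).card : ℕ) *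
                exp (-(siteDist G A B : ℝ) / clusterLength v' μ' β) := by
  have hμ : 0 < μ₀ / 2 := by positivity
  have hS := latticeSum_pos D hγ hμ
  refine ⟨4 * g₀ * latticeSum D γ (μ₀ / 2) ^ 2 / (g + g₀ * latticeSum D γ (μ₀ / 2)),
    2 * (g + g₀ * latticeSum D γ (μ₀ / 2)), μ₀ / 2, by positivity, by positivity, hμ, ?_⟩
  intro Λ _ _ d₀ G h hd hL hI
  refine ⟨liebRobinsonBound_of_isShortRange hγ hg hg₀ hμ₀ hL hI, ?_⟩
  intro C' v' μ' hC hv hμ' hLR β hβ A B hA hB hA' hB' OA OB hOA hOB hA1 hB1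
  have hH : (hamiltonian h).IsHermitian := isHermitian_sum _ hI.hermitian
  have key := fun (α : ℝ) (h0 : 0 ≤ α) (h1 : α ≤ 1) =>
    norm_wydCorrelation_le hL.connected hd hH hC hv hμ' hβ hLR hA hB hA' hB' hOA hOB hA1 hB1 h0 h1
  refine ⟨key, (continuous_wydCorrelation hH β OA OB).intervalIntegrable 0 1, ?_⟩
  refine (intervalIntegral.norm_integral_le_of_norm_le_const fun α hα => ?_).trans
    (by rw [sub_zero, abs_one, mul_one])
  rw [Set.uIoc_of_le zero_le_one] at hα
  exact key α hα.1.le hα.2
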